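/- **Proposition (existence for the ramified optimal allocation problem).** Let $X\subset\mathbb R^d$ be compact and convex, let $x_1,\dots,x_k\in X$ ($k\ge 1$) be distinct points, let $\mathbf b=\sum_{j=1}^{\ell} n_j\delta_{y_j}$ with distinct points $y_j\in X$, $n_j>0$ and $\sum_j n_j=1$, and let $\alpha\in[0,1)$. *Definitions.* For a finite atomic probability measure $\mathbf a$ on $X$, a transport path $G\in Path(\mathbf a,\mathbf b)$ is a finite directed graph whose vertex set $V(G)\subset X$ contains all atoms of $\mathbf a$ and $\mathbf b$, whose edges are nondegenerate directed line segments between vertices with weights $w(e)>0$, which contains no cycles (as an undirected graph, a pair of opposite edges counting as a cycle), and which satisfies at each vertex $v$ the balance equation $$\sum_{e^-=v}w(e)=\sum_{e^+=v}w(e)+\mathbf a(\{v\})-\mathbf b(\{v\}),$$ where $e^-$ and $e^+$ are the starting and the ending point of $e$. Its cost is $\mathbf M_\alpha(G)=\sum_e w(e)^\alpha\,\mathrm{length}(e)$, and $d_\alpha(\mathbf a,\mathbf b)=\inf\{\mathbf M_\alpha(G):G\in Path(\mathbf a,\mathbf b)\}$. An allocation plan $q\in Plan[\mathbf x,\mathbf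 b]$ is a matrix $(q_{ij})_{k\times\ell}$ with $q_{ij}\ge 0$ and $\sum_i q_{ij}=n_j$ for each $j$; it stands for the measure $\sum_{i,j}q_{ij}\delta_{(x_i,y_j)}$. Put $\mathbf a(q)=\sum_i\bigl(\sum_j q_{ij}\bigr)\delta_{x_i}$. For $G\in Path(\mathbf a(q),\mathbf b)$ let $g_{ij}$ be the directed curve on $G$ from $x_i$ to $y_j$ through distinct vertices; there is at most one, and it consists of a single vertex if $x_i=y_j$ is a vertex of $G$. The pair $(G,q)$ is compatible if $q_{ij}=0$ whenever there is no such curve, and $w(e)=\sum_{(i,j):\,e\subset g_{ij}}q_{ij}$ for every edge $e$, that is, $G=\sum_{i,j}q_{ij}\,g_{ij}$. Finally $$\mathbf T_\alpha(q)=\inf\{\mathbf M_\alpha(G):G\in Path(\mathbf a(q),\mathbf b),\ (G,q)\text{ compatible}\}\in[0,+\infty],$$ where $\inf\emptyset=+\infty$. *Claim.* There is $q^*\in Plan[\mathbf x,\mathbf b]$ with $\mathbf T_\alpha(q^*)\le\mathbf T_\alpha(q)$ for all $q\in Plan[\mathbf x,\mathbf b]$, and the infimum defining $\mathbf T_\alpha(q^*)$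 is attained by a compatible path. With $K=\{m\in[0,\infty)^k:\sum_i m_i=1\}$, there is likewise $m^*\in K$ which minimizes $m\mapsto d_\alpha\bigl(\sum_i m_i\delta_{x_i},\mathbf b\bigr)$ over $K$, and the infimum defining $d_\alpha\bigl(\sum_i m^*_i\delta_{x_i},\mathbf b\bigr)$ is attained by a transport path. Moreover both minimum values are finite and $$\min\{\mathbf T_\alpha(q):q\in Plan[\mathbf x,\mathbf b]\}=\min\Bigl\{d_\alpha\Bigl(\sum_{i=1}^k m_i\delta_{x_i},\mathbf b\Bigr):m\in K\Bigr\}.$$ -/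

import Mathlib

open MeasureTheory
open scoped ENNReal

noncomputable section

namespace RamifiedAllocation

/-- The atomic measure `∑ i, c i • δ_{z i}` (points carrying the coefficient `0` are not atoms). -/
def atomicMeasure {d s : ℕ} (z : Fin s → EuclideanSpace ℝ (Fin d)) (c : Fin s → ℝ) :
    Measure (EuclideanSpace ℝ (Fin d)) :=
  ∑ i, ENNReal.ofReal (c i) • Measure.dirac (z i)

/-- A finite weighted directed graph whose vertices are points of `ℝ^d`. The pair `(u, v)` is the
directed segment from `u` to `v`; only the weights of edges matter. -/
structure WeightedDigraph (d : ℕ) where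
  verts : Finset (EuclideanSpace ℝ (Fin d))
  edges : Finset (EuclideanSpace ℝ (Fin d) × EuclideanSpace ℝ (Fin d))
  weight : EuclideanSpace ℝ (Fin d) × EuclideanSpace ℝ (Fin d) → ℝ
  fst_mem : ∀ e ∈ edges, e.1 ∈ verts
  snd_mem : ∀ e ∈ edges, e.2 ∈ verts
  fst_ne_snd : ∀ e ∈ edges, e.1 ≠ e.2
  weight_pos : ∀ e ∈ edges, 0 < weight e

namespace WeightedDigraph

variable {d : ℕ}

/-- Total weight of the edges starting at `v`. -/
def outFlow (G : WeightedDigraph d) (v : EuclideanSpace ℝ (Fin d)) : ℝ :=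
  ∑ e ∈ G.edges with e.1 = v, G.weight e

/-- Total weight of the edges ending at `v`. -/
def inFlow (G : WeightedDigraph d) (v : EuclideanSpace ℝ (Fin d)) : ℝ :=
  ∑ e ∈ G.edges with e.2 = v, G.weight e

/-- The underlying undirected simple graph. -/
def underlying (G : WeightedDigraph d) : SimpleGraph (EuclideanSpace ℝ (Fin d)) :=
  SimpleGraph.fromRel (fun u v => (u, v) ∈ G.edges)

/-- `G` contains no cycles, regardless of the directions of the edges. A pair of opposite edges
`(u, v)`, `(v, u)`, which the underlying simple graph does not see, counts as a cycle. -/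
def NoCycles (G : WeightedDigraph d) : Prop :=
  G.underlying.IsAcyclic ∧ ∀ e ∈ G.edges, e.swap ∉ G.edges

/-- The `M_α` cost `∑_e w(e)^α * length(e)`. -/
def cost (α : ℝ) (G : WeightedDigraph d) : ℝ :=
  ∑ e ∈ G.edges, G.weight e ^ α * dist e.1 e.2

/-- `l` lists the vertices of a directed polyhedral curve on `G` from `u` to `v`: distinct
vertices of `G`, consecutive ones being joined by a directed edge of `G`. -/
def IsCurve (G : WeightedDigraph d) (u v : EuclideanSpace ℝ (Fin d))
    (l : List (EuclideanSpace ℝ (Fin d))) : Prop :=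
  l.head? = some u ∧ l.getLast? = some v ∧ l.Nodup ∧ (∀ p ∈ l, p ∈ G.verts) ∧
    l.IsChain (fun s t => (s, t) ∈ G.edges)

/-- The edge `e` lies on a directed polyhedral curve on `G` from `u` to `v`
(there is at most one such curve if `G` has no cycles). -/
def EdgeOnCurve (G : WeightedDigraph d) (u v : EuclideanSpace ℝ (Fin d))
    (e : EuclideanSpace ℝ (Fin d) × EuclideanSpace ℝ (Fin d)) : Prop :=
  ∃ l, G.IsCurve u v l ∧ e ∈ l.zip l.tail

end WeightedDigraph

/-- `Path(a, b)`: the transport paths from `a` to `b` in `X`, without cycles. The balance equation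
is `∂G = b - a`, read at each vertex. -/
def transportPaths {d : ℕ} (X : Set (EuclideanSpace ℝ (Fin d)))
    (a b : Measure (EuclideanSpace ℝ (Fin d))) : Set (WeightedDigraph d) :=
  {G | (∀ v ∈ G.verts, v ∈ X) ∧
    (∀ v, a {v} ≠ 0 ∨ b {v} ≠ 0 → v ∈ G.verts) ∧
    (∀ v ∈ G.verts, G.outFlow v = G.inFlow v + (a.real {v} - b.real {v})) ∧
    G.NoCycles}

/-- The minimal transportation cost `d_α(a, b)` (the infimum, `⊤` if there is no path). -/
def minCost {d : ℕ} (X : Set (EuclideanSpace ℝ (Fin d))) (α : ℝ)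
    (a b : Measure (EuclideanSpace ℝ (Fin d))) : ℝ≥0∞ :=
  ⨅ G ∈ transportPaths X a b, ENNReal.ofReal (G.cost α)

/-- `Plan[x, b]`: the measure `∑ i j, q i j • δ_{(x i, y j)}` is given by its coefficients. -/
def allocationPlans (k : ℕ) {ℓ : ℕ} (n : Fin ℓ → ℝ) : Set (Fin k → Fin ℓ → ℝ) :=
  {q | (∀ i j, 0 ≤ q i j) ∧ ∀ j, ∑ i, q i j = n j}

/-- The production `m_i(q) = ∑ j, q i j` of factory `i` under the plan `q`. -/
def production {k ℓ : ℕ} (q : Fin k → Fin ℓ → ℝ) : Fin k → ℝ :=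
  fun i => ∑ j, q i j

open Classical in
/-- Compatibility of a path `G` and a plan `q`: `q i j = 0` if there is no curve `g i j` on `G` from
`x i` to `y j`, and `G = ∑ i j, q i j • g i j`. On a graph without cycles the equality of polyhedral
chains is the equality of the coefficients of each edge. -/
def Compatible {d k ℓ : ℕ} (x : Fin k → EuclideanSpace ℝ (Fin d))
    (y : Fin ℓ → EuclideanSpace ℝ (Fin d)) (G : WeightedDigraph d) (q : Fin k → Fin ℓ → ℝ) : Prop :=
  (∀ i j, (¬ ∃ l, G.IsCurve (x i) (y j) l) → q i j = 0) ∧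
    ∀ e ∈ G.edges, G.weight e = ∑ i, ∑ j, if G.EdgeOnCurve (x i) (y j) e then q i j else 0

/-- The transport paths from `a(q)` to `b` that are compatible with `q`. -/
def compatiblePaths {d k ℓ : ℕ} (X : Set (EuclideanSpace ℝ (Fin d)))
    (x : Fin k → EuclideanSpace ℝ (Fin d)) (y : Fin ℓ → EuclideanSpace ℝ (Fin d)) (n : Fin ℓ → ℝ)
    (q : Fin k → Fin ℓ → ℝ) : Set (WeightedDigraph d) :=
  {G | G ∈ transportPaths X (atomicMeasure x (production q)) (atomicMeasure y n) ∧
    Compatible x y G q}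

/-- The ramified transportation cost `T_α(q)` (the infimum, `⊤` if no path is compatible with
`q`). -/
def planCost {d k ℓ : ℕ} (X : Set (EuclideanSpace ℝ (Fin d))) (α : ℝ)
    (x : Fin k → EuclideanSpace ℝ (Fin d)) (y : Fin ℓ → EuclideanSpace ℝ (Fin d)) (n : Fin ℓ → ℝ)
    (q : Fin k → Fin ℓ → ℝ) : ℝ≥0∞ :=
  ⨅ G ∈ compatiblePaths X x y n q, ENNReal.ofReal (G.cost α)

end RamifiedAllocation

end

/-!
A weighted directed graph is treated as a real `1`-chain on pairs of points, that is, as a finitely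
supported function `w` on `V × V`. Its boundary is tested against arbitrary functions `φ` on the
points: `flux φ w = ∑ e, w e * (φ e.2 - φ e.1)`. The balance equations of a transport path say that
`flux φ w = ∑ j, n j * φ (y j) - ∑ i, m i * φ (x i)` for all `φ` (`Carries`), and a graph has no
cycles exactly when no nonzero chain on its edges has zero boundary (`CycleFree`).

*Plans and paths.* A path that is compatible with a plan `q` is a transport path from the production
of `q`, so `T_α(q)` is at least `d_α(a(q), b)`. Conversely every transport path is compatible with
some plan (`exists_mem_compatiblePaths`). Following the positive edges from a producing `x i` one
reaches a consumer `y j`, since no mass leaves the set of reachable points; subtracting a multiple of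
the walk and repeating this yields a plan with the right marginals that ships along directed curves
only (`exists_plan`). The chain `∑ i j, q i j • g i j` then has the same boundary as `G`, so it is `G`,
because `G` has no cycles (`WeightedDigraph.NoCycles.compatible`). Hence it suffices to find a
cheapest path over all productions `m`.

*Reduction to boundedly many edges.* As `t ↦ t ^ α` is concave, a cycle can be added to a chain in one
of its two directions, without increasing the cost, until an edge disappears. A vertex which is
neither an `x i` nor a `y j` and has fewer than three edges has one incoming and one outgoing edge
of equal weight, and these can be replaced by a single segment. On a chain without cycles the boundary
map is injective, so there are at most as many edges as vertices, and counting incidences bounds the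
number of edges by `3 * (k + ℓ)` (`exists_reduced`).

*Compactness.* Families of `3 * (k + ℓ)` segments in `X` with weights in `[0, 1]`, together with a
production vector, form a compact set; the condition on the boundary is closed, because it may be
tested against continuous `φ` only. The cost is continuous on it, also for `α = 0`, where a segment of
weight zero is charged its length. Each reduced chain fills up to such a family of the same cost by
adding degenerate segments, and its weights are at most one, as cutting an edge shows. Conversely the
chain of a family costs at most as much as the family, by subadditivity. So a minimizing family
provides, after a further reduction, an optimal path (`exists_minimal_carries`).
-/

namespace RamifiedAllocation

/-! ### Chains, their boundary, and plans -/

section Chains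

variable {V : Type*}

/-- The boundary of the `1`-chain `∑ e, w e • [e.1, e.2]`, tested against a function `φ` on the
vertices. -/
noncomputable def flux (φ : V → ℝ) : (V × V →₀ ℝ) →ₗ[ℝ] ℝ :=
  Finsupp.linearCombination ℝ fun e => φ e.2 - φ e.1

lemma flux_eq_sum (φ : V → ℝ) {w : V × V →₀ ℝ} {S : Finset (V × V)} (h : w.support ⊆ S) :
    flux φ w = ∑ e ∈ S, w e * (φ e.2 - φ e.1) := by
  rw [flux, Finsupp.linearCombination_apply, Finsupp.sum_of_support_subset _ h _ (by simp)]
  simp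

@[simp]
lemma flux_single (φ : V → ℝ) (e : V × V) (a : ℝ) :
    flux φ (Finsupp.single e a) = a * (φ e.2 - φ e.1) := by
  simp [flux]

/-- A set of directed edges carries no cycle: no nonzero real `1`-chain on it has zero boundary. -/
def CycleFree (S : Finset (V × V)) : Prop :=
  ∀ z : V × V →₀ ℝ, z.support ⊆ S → (∀ φ : V → ℝ, flux φ z = 0) → z = 0

lemma CycleFree.fst_ne_snd {S : Finset (V × V)} (hS : CycleFree S) {e : V × V}
    (he : e ∈ S) : e.1 ≠ e.2 := fun h => by
  have := hS (Finsupp.single e 1) (Finsupp.support_single_subset.trans (by simpa using he))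
    (fun φ => by simp [h])
  simp at this

/-- Subtracting the largest admissible multiple of `z` from a nonnegative `w` keeps it nonnegative
and empties one point of the support. -/
lemma exists_sub_smul_nonneg {ι : Type*} {w z : ι →₀ ℝ} (hw : ∀ i, 0 ≤ w i)
    (hz : z.support ⊆ w.support) (hpos : ∃ i, 0 < z i) :
    ∃ t : ℝ, 0 < t ∧ (∀ i, 0 ≤ (w - t • z) i) ∧ (w - t • z).support ⊂ w.support := by
  classical
  obtain ⟨i₀, hi₀⟩ := hpos
  have hne : (z.support.filter fun i => 0 < z i).Nonempty :=
    ⟨i₀, by simp [hi₀, hi₀.ne']⟩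
  obtain ⟨i, hi, hmin⟩ := Finset.exists_min_image _ (fun i => w i / z i) hne
  rw [Finset.mem_filter] at hi
  have hwi : 0 < w i := (hw i).lt_of_ne' (Finsupp.mem_support_iff.1 (hz hi.1))
  refine ⟨w i / z i, div_pos hwi hi.2, fun j => ?_, ?_⟩
  · simp only [Finsupp.coe_sub, Finsupp.coe_smul, Pi.sub_apply, Pi.smul_apply, smul_eq_mul]
    rcases le_or_gt (z j) 0 with hj | hj
    · have := mul_nonpos_of_nonneg_of_nonpos (div_pos hwi hi.2).le hj
      linarith [hw j]
    · have := hmin j (by simp [hj, hj.ne'])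
      rw [le_div_iff₀ hj] at this
      linarith
  · refine (Finset.ssubset_iff_of_subset fun j hj => ?_).2 ⟨i, hz hi.1, ?_⟩
    · by_contra hj'
      have h1 := Finsupp.notMem_support_iff.1 hj'
      have h2 := Finsupp.notMem_support_iff.1 fun h => hj' (hz h)
      simp [h1, h2] at hj
    · simp [hi.2.ne']

/-- A directed walk yields a nonnegative chain on the edges it uses, with boundary
`[v] - [u]`. -/
lemma exists_chain_of_reflTransGen {S : Finset (V × V)} {u v : V}
    (h : Relation.ReflTransGen (fun s t => (s, t) ∈ S) u v) :
    ∃ c : V × V →₀ ℝ, (∀ e, 0 ≤ c e) ∧ c.support ⊆ S ∧ ∀ φ : V → ℝ, flux φ c = φ v - φ u := by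
  classical
  induction h with
  | refl => exact ⟨0, by simp, by simp, by simp⟩
  | @tail b c' _ hbc ih =>
    obtain ⟨c, hc0, hcS, hcφ⟩ := ih
    refine ⟨c + Finsupp.single (b, c') 1, fun e => ?_, ?_, fun φ => ?_⟩
    · exact add_nonneg (hc0 e) (Finsupp.single_nonneg.2 zero_le_one e)
    · refine Finsupp.support_add.trans (Finset.union_subset hcS ?_)
      exact Finsupp.support_single_subset.trans (by simpa using hbc)
    · simp [hcφ]

/-- A nonnegative chain that carries production `m` at the points `x` to consumption `n` at the
points `y` can be matched by a plan that ships only along its directed walks. The proof is by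
induction on a bound `N` for the number of edges, factories and consumers in use. -/
lemma exists_plan {k ℓ : ℕ} (x : Fin k → V) (y : Fin ℓ → V) :
    ∀ (N : ℕ) (w : V × V →₀ ℝ) (m : Fin k → ℝ) (n : Fin ℓ → ℝ), (∀ e, 0 ≤ w e) →
      (∀ i, 0 ≤ m i) → (∀ j, 0 ≤ n j) →
      (∀ φ : V → ℝ, flux φ w = ∑ j, n j * φ (y j) - ∑ i, m i * φ (x i)) →
      w.support.card + (Finset.univ.filter fun i => m i ≠ 0).card +
        (Finset.univ.filter fun j => n j ≠ 0).card ≤ N →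
      ∃ q : Fin k → Fin ℓ → ℝ, (∀ i j, 0 ≤ q i j) ∧ (∀ i, ∑ j, q i j = m i) ∧
        (∀ j, ∑ i, q i j = n j) ∧
        ∀ i j, q i j ≠ 0 → Relation.ReflTransGen (fun s t => (s, t) ∈ w.support) (x i) (y j) := by
  classical
  intro N
  induction N with
  | zero =>
    intro w m n hw hm hn hflux hN
    have h1 : ∀ i, m i = 0 := by
      have : (Finset.univ.filter fun i => m i ≠ 0) = ∅ := Finset.card_eq_zero.1 (by omega)
      simpa [Finset.filter_eq_empty_iff] using this
    have h2 : ∀ i, n i = 0 := by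
      have : (Finset.univ.filter fun i => n i ≠ 0) = ∅ := Finset.card_eq_zero.1 (by omega)
      simpa [Finset.filter_eq_empty_iff] using this
    exact ⟨0, by simp, by simp [h1], by simp [h2], by simp⟩
  | succ N IH =>
    intro w m n hw hm hn hflux hN
    by_cases hm0 : ∀ i, m i = 0
    · -- equality of the total masses forces the consumption to vanish as well
      have h1 := hflux fun _ => 1
      have h2 : ∑ j, n j = 0 := by
        have h3 : flux (fun _ => 1) w = 0 := by simp [flux_eq_sum _ (subset_refl w.support)]
        rw [h3] at h1
        simpa [hm0, eq_comm] using h1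
      have h3 : ∀ j, n j = 0 := fun j =>
        (Finset.sum_eq_zero_iff_of_nonneg fun j _ => hn j).1 h2 j (Finset.mem_univ j)
      exact ⟨0, by simp, by simp [hm0], by simp [h3], by simp⟩
    push Not at hm0
    obtain ⟨i, hi⟩ := hm0
    have hmi : 0 < m i := (hm i).lt_of_ne' hi
    let R := Relation.ReflTransGen (fun s t => (s, t) ∈ w.support) (x i)
    -- no mass leaves the set of points reachable from `x i`, hence some of it is consumed there
    obtain ⟨j, hj, hnj⟩ : ∃ j, R (y j) ∧ 0 < n j := by
      by_contra! hcon
      have h1 := hflux fun v => if R v then 1 else 0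
      have h2 : 0 ≤ flux (fun v => if R v then 1 else 0) w := by
        rw [flux_eq_sum _ (subset_refl w.support)]
        refine Finset.sum_nonneg fun e he => mul_nonneg (hw e) ?_
        by_cases h : R e.1
        · have : R e.2 := h.tail he
          simp [h, this]
        · simp only [h, if_false, sub_zero]
          split_ifs <;> norm_num
      have h3 : ∑ j, n j * (if R (y j) then 1 else 0) ≤ 0 :=
        Finset.sum_nonpos fun j _ => by
          split_ifs with h
          · simpa using hcon j h
          · simp
      have h4 : m i ≤ ∑ i, m i * (if R (x i) then 1 else 0) := by
        have := Finset.single_le_sum (f := fun i => m i * (if R (x i) then (1 : ℝ) else 0))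
          (fun i _ => mul_nonneg (hm i) (by split_ifs <;> norm_num)) (Finset.mem_univ i)
        have hR : R (x i) := Relation.ReflTransGen.refl
        simpa [hR] using this
      linarith
    obtain ⟨c, hc0, hcS, hcφ⟩ := exists_chain_of_reflTransGen hj
    -- an amount that may be shipped along the walk and exhausts an edge, the factory, or the consumer
    obtain ⟨t, ht0, hti, htj, htw, htdec⟩ : ∃ t : ℝ, 0 < t ∧ t ≤ m i ∧ t ≤ n j ∧
        (∀ e, 0 ≤ (w - t • c) e) ∧
        ((w - t • c).support ⊂ w.support ∨ t = m i ∨ t = n j) := by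
      have hmono : ∀ s t : ℝ, s ≤ t → (∀ e, 0 ≤ (w - t • c) e) → ∀ e, 0 ≤ (w - s • c) e := by
        intro s t hst h e
        have h1 := h e
        have h2 := mul_le_mul_of_nonneg_right hst (hc0 e)
        simp only [Finsupp.coe_sub, Finsupp.coe_smul, Pi.sub_apply, Pi.smul_apply,
          smul_eq_mul] at h1 ⊢
        linarith
      by_cases hc : c = 0
      · refine ⟨min (m i) (n j), lt_min hmi hnj, min_le_left _ _, min_le_right _ _, ?_, Or.inr ?_⟩
        · simpa [hc] using hw
        · exact min_choice _ _
      · obtain ⟨e, he⟩ := Finsupp.ne_iff.1 hc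
        obtain ⟨s, hs0, hsw, hss⟩ := exists_sub_smul_nonneg hw hcS ⟨e, (hc0 e).lt_of_ne' he⟩
        rcases le_total s (min (m i) (n j)) with h | h
        · exact ⟨s, hs0, h.trans (min_le_left _ _), h.trans (min_le_right _ _), hsw, Or.inl hss⟩
        · exact ⟨min (m i) (n j), lt_min hmi hnj, min_le_left _ _, min_le_right _ _,
            hmono _ _ h hsw, Or.inr (min_choice _ _)⟩
    have hsub : (w - t • c).support ⊆ w.support := fun e he => by
      by_contra he'
      have h1 := Finsupp.notMem_support_iff.1 he'
      have h2 := Finsupp.notMem_support_iff.1 fun h => he' (hcS h)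
      simp [h1, h2] at he
    have hm' : ∀ i', m i' = 0 → (m - Pi.single i t : Fin k → ℝ) i' = 0 := fun i' h => by
      have : i' ≠ i := by rintro rfl; exact hi h
      simp [h, this]
    have hn' : ∀ j', n j' = 0 → (n - Pi.single j t : Fin ℓ → ℝ) j' = 0 := fun j' h => by
      have : j' ≠ j := by rintro rfl; exact hnj.ne' h
      simp [h, this]
    have hmc : (Finset.univ.filter fun i' => (m - Pi.single i t : Fin k → ℝ) i' ≠ 0) ⊆
        Finset.univ.filter fun i' => m i' ≠ 0 := fun i' => by
      simpa using fun h h' => h (by simpa using hm' i' h')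
    have hnc : (Finset.univ.filter fun j' => (n - Pi.single j t : Fin ℓ → ℝ) j' ≠ 0) ⊆
        Finset.univ.filter fun j' => n j' ≠ 0 := fun j' => by
      simpa using fun h h' => h (by simpa using hn' j' h')
    obtain ⟨q, hq0, hqm, hqn, hqR⟩ := IH (w - t • c) (m - Pi.single i t) (n - Pi.single j t) htw
      (fun i' => by
        by_cases h : i' = i
        · subst h; simpa using hti
        · simpa [h] using hm i')
      (fun j' => by
        by_cases h : j' = j
        · subst h; simpa using htj
        · simpa [h] using hn j')
      (fun φ => by
        simp only [map_sub, map_smul, hflux, hcφ, Pi.sub_apply, sub_mul, Finset.sum_sub_distrib,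
          Pi.single_apply, ite_mul, zero_mul, Finset.sum_ite_eq', Finset.mem_univ, if_true,
          smul_eq_mul]
        ring)
      (by
        have h1 := Finset.card_le_card hsub
        have h2 := Finset.card_le_card hmc
        have h3 := Finset.card_le_card hnc
        rcases htdec with h | h | h
        · have := Finset.card_lt_card h
          omega
        · have := Finset.card_lt_card ((Finset.ssubset_iff_of_subset hmc).2
            ⟨i, by simp [hi], by simp [h]⟩)
          omega
        · have := Finset.card_lt_card ((Finset.ssubset_iff_of_subset hnc).2
            ⟨j, by simp [hnj.ne'], by simp [h]⟩)
          omega)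
    refine ⟨fun i' j' => q i' j' + if i' = i ∧ j' = j then t else 0, fun i' j' => ?_, fun i' => ?_,
      fun j' => ?_, fun i' j' h => ?_⟩
    · refine add_nonneg (hq0 _ _) ?_
      split_ifs
      exacts [ht0.le, le_rfl]
    · rw [Finset.sum_add_distrib, hqm]
      by_cases h : i' = i
      · simp [h]
      · simp [h]
    · rw [Finset.sum_add_distrib, hqn]
      by_cases h : j' = j
      · simp [h]
      · simp [h]
    · by_cases h' : i' = i ∧ j' = j
      · rw [h'.1, h'.2]; exact hj
      · simp only [if_neg h', add_zero] at h
        exact Relation.ReflTransGen.mono (fun _ _ h => hsub h) _ _ (hqR i' j' h)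

end Chains

/-! ### Graphs without cycles and their curves -/

section Graphs

variable {d : ℕ}

/-- A walk in an undirected graph, each of whose edges lies in `S` in some direction, yields a
real chain on `S` with boundary `[v] - [u]`; edges of `S` run backwards get the coefficient `-1`. -/
lemma exists_chain_of_reachable {V : Type*} {H : SimpleGraph V} {S : Finset (V × V)}
    (hS : ∀ u v, H.Adj u v → (u, v) ∈ S ∨ (v, u) ∈ S) {u v : V} (h : H.Reachable u v) :
    ∃ c : V × V →₀ ℝ, c.support ⊆ S ∧ ∀ φ : V → ℝ, flux φ c = φ v - φ u := by
  classical
  obtain ⟨p⟩ := h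
  induction p with
  | nil => exact ⟨0, by simp, by simp⟩
  | @cons a b c' hab _ ih =>
    obtain ⟨c, hcS, hcφ⟩ := ih
    rcases hS a b hab with h | h
    · refine ⟨c + Finsupp.single (a, b) 1, ?_, fun φ => by simp [hcφ]⟩
      refine Finsupp.support_add.trans (Finset.union_subset hcS ?_)
      exact Finsupp.support_single_subset.trans (by simpa using h)
    · refine ⟨c + Finsupp.single (b, a) (-1), ?_, fun φ => by simp [hcφ]⟩
      refine Finsupp.support_add.trans (Finset.union_subset hcS ?_)
      exact Finsupp.support_single_subset.trans (by simpa using h)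

namespace WeightedDigraph

lemma underlying_adj {G : WeightedDigraph d} {u v : EuclideanSpace ℝ (Fin d)} :
    G.underlying.Adj u v ↔ u ≠ v ∧ ((u, v) ∈ G.edges ∨ (v, u) ∈ G.edges) := by
  simp [underlying]

/-- In a graph without cycles every edge is a bridge, so it is cut by the indicator function of one
side of the bridge. -/
lemma NoCycles.exists_cut {G : WeightedDigraph d} (hG : G.NoCycles)
    {e : EuclideanSpace ℝ (Fin d) × EuclideanSpace ℝ (Fin d)} (he : e ∈ G.edges) :
    ∃ φ : EuclideanSpace ℝ (Fin d) → ℝ, (∀ v, 0 ≤ φ v ∧ φ v ≤ 1) ∧ φ e.1 = 0 ∧ φ e.2 = 1 ∧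
      ∀ e' ∈ G.edges, e' ≠ e → φ e'.1 = φ e'.2 := by
  classical
  obtain ⟨u, v⟩ := e
  have hadj : G.underlying.Adj u v := underlying_adj.2 ⟨G.fst_ne_snd _ he, Or.inl he⟩
  have hb := SimpleGraph.isBridge_iff.1 (SimpleGraph.isAcyclic_iff_forall_adj_isBridge.1 hG.1 hadj)
  set H := G.underlying.deleteEdges {s(u, v)} with hH
  refine ⟨fun p => if H.Reachable v p then 1 else 0, fun p => ?_, ?_, ?_, fun e' he' hne => ?_⟩
  · dsimp only
    split_ifs <;> norm_num
  · exact if_neg fun h => hb h.symm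
  · exact if_pos (SimpleGraph.Reachable.refl v)
  · have hadj' : H.Adj e'.1 e'.2 := by
      rw [hH, SimpleGraph.deleteEdges_adj]
      refine ⟨underlying_adj.2 ⟨G.fst_ne_snd _ he', Or.inl he'⟩, fun h2 => ?_⟩
      rw [Set.mem_singleton_iff, Sym2.eq_iff] at h2
      rcases h2 with h2 | h2
      · exact hne (Prod.ext h2.1 h2.2)
      · refine hG.2 _ he ?_
        rw [show Prod.swap (u, v) = e' from Prod.ext h2.1.symm h2.2.symm]
        exact he'
    have : H.Reachable v e'.1 ↔ H.Reachable v e'.2 :=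
      ⟨fun h => h.trans hadj'.reachable, fun h => h.trans hadj'.symm.reachable⟩
    simp [this]

lemma NoCycles.cycleFree {G : WeightedDigraph d} (hG : G.NoCycles) : CycleFree G.edges := by
  intro z hz hflux
  ext e
  by_cases he : e ∈ G.edges
  · obtain ⟨φ, -, h0, h1, hφ⟩ := hG.exists_cut he
    have h := hflux φ
    rw [flux_eq_sum φ hz, Finset.sum_eq_single_of_mem e he fun e' he' hne => by
      simp [hφ e' he' hne], h0, h1] at h
    simpa using h
  · simpa using Finsupp.notMem_support_iff.1 fun h => he (hz h)

lemma noCycles_of_cycleFree {G : WeightedDigraph d} (hG : CycleFree G.edges) : G.NoCycles := by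
  classical
  have hswap : ∀ e ∈ G.edges, e.swap ∉ G.edges := by
    intro e he he'
    have hne : e.swap ≠ e := fun h => G.fst_ne_snd e he (Prod.ext_iff.1 h).2
    have h := hG (Finsupp.single e 1 + Finsupp.single e.swap 1)
      (Finsupp.support_add.trans (Finset.union_subset
        (Finsupp.support_single_subset.trans (by simpa using he))
        (Finsupp.support_single_subset.trans (by simpa using he'))))
      (fun φ => by simp)
    have := DFunLike.congr_fun h e
    simp [hne] at this
  refine ⟨SimpleGraph.isAcyclic_iff_forall_adj_isBridge.2 fun u v huv => ?_, hswap⟩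
  have key : ∀ u v, (u, v) ∈ G.edges →
      ¬ (G.underlying.deleteEdges {s(u, v)}).Reachable u v := by
    intro u v he hr
    obtain ⟨c, hcS, hcφ⟩ := exists_chain_of_reachable (S := G.edges.erase (u, v)) (by
      intro a b hab
      rw [SimpleGraph.deleteEdges_adj, underlying_adj] at hab
      obtain ⟨⟨-, h⟩, hab'⟩ := hab
      refine h.imp (fun h => Finset.mem_erase.2 ⟨?_, h⟩) (fun h => Finset.mem_erase.2 ⟨?_, h⟩)
      · rintro h'
        rw [Prod.mk.injEq] at h'
        exact hab' (by simp [h'.1, h'.2])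
      · rintro h'
        rw [Prod.mk.injEq] at h'
        exact hab' (by simp [h'.1, h'.2, Sym2.eq_swap])) hr
    have h := hG (c - Finsupp.single (u, v) 1)
      (Finsupp.support_sub.trans (Finset.union_subset (hcS.trans (Finset.erase_subset _ _))
        (Finsupp.support_single_subset.trans (by simpa using he))))
      (fun φ => by simp [hcφ])
    have hc : c (u, v) = 0 := Finsupp.notMem_support_iff.1 fun h' => by simpa using hcS h'
    have := DFunLike.congr_fun h (u, v)
    simp [hc] at this
  rw [SimpleGraph.isBridge_iff]
  rcases (underlying_adj.1 huv).2 with h | h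
  · exact key u v h
  · intro hr
    refine key v u h ?_
    rw [Sym2.eq_swap]
    exact hr.symm

/-- Directed reachability provides a curve through distinct vertices: a curve that would return to
one of its vertices is cut off there. -/
lemma exists_isCurve {G : WeightedDigraph d} {u v : EuclideanSpace ℝ (Fin d)} (hu : u ∈ G.verts)
    (h : Relation.ReflTransGen (fun s t => (s, t) ∈ G.edges) u v) : ∃ l, G.IsCurve u v l := by
  induction h with
  | refl => exact ⟨[u], by simp [IsCurve, hu]⟩
  | @tail b c _ hbc ih =>
    obtain ⟨l, hhead, hlast, hnd, hverts, hchain⟩ := ih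
    by_cases hc : c ∈ l
    · obtain ⟨l₁, l₂, rfl⟩ := List.append_of_mem hc
      have hpre : l₁ ++ [c] <+: l₁ ++ c :: l₂ := ⟨l₂, by simp⟩
      refine ⟨l₁ ++ [c], ?_, by simp, hnd.sublist hpre.sublist,
        fun p hp => hverts p (hpre.subset hp), hchain.prefix hpre⟩
      cases l₁ <;> simpa using hhead
    · refine ⟨l ++ [c], ?_, by simp, ?_, ?_, ?_⟩
      · cases l <;> simp_all
      · rw [List.nodup_append]
        refine ⟨hnd, by simp, fun a ha b hb => ?_⟩
        rintro rfl
        simp only [List.mem_singleton] at hb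
        exact hc (hb ▸ ha)
      · intro p hp
        rcases List.mem_append.1 hp with hp | hp
        · exact hverts p hp
        · simp only [List.mem_singleton] at hp
          exact hp ▸ G.snd_mem _ hbc
      · rw [List.isChain_append]
        refine ⟨hchain, by simp, ?_⟩
        intro s hs t ht
        rw [hlast] at hs
        simp at hs ht
        rw [← hs, ← ht]
        exact hbc

end WeightedDigraph

/-- The chain of unit weight along the polyhedral curve through the points of `l`. -/
noncomputable def curveChain {V : Type*} (l : List V) : V × V →₀ ℝ :=
  ((l.zip l.tail).map fun e => Finsupp.single e 1).sum

lemma curveChain_cons_cons {V : Type*} (a b : V) (l : List V) :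
    curveChain (a :: b :: l) = Finsupp.single (a, b) 1 + curveChain (b :: l) := by
  simp [curveChain]

lemma flux_curveChain {V : Type*} (φ : V → ℝ) :
    ∀ {l : List V} {u v : V}, l.head? = some u → l.getLast? = some v →
      flux φ (curveChain l) = φ v - φ u
  | [], _, _, h, _ => by simp at h
  | [a], u, v, h, h' => by
    simp at h h'
    simp [curveChain, ← h, ← h']
  | a :: b :: l, u, v, h, h' => by
    have := flux_curveChain φ (l := b :: l) (u := b) (v := v) rfl (by simpa using h')
    simp at h
    rw [curveChain_cons_cons, map_add, this, flux_single, ← h]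
    ring

lemma support_curveChain_subset {V : Type*} {S : Finset (V × V)} :
    ∀ {l : List V}, l.IsChain (fun s t => (s, t) ∈ S) → (curveChain l).support ⊆ S
  | [], _ => by simp [curveChain]
  | [a], _ => by simp [curveChain]
  | a :: b :: l, h => by
    classical
    rw [List.isChain_cons_cons] at h
    rw [curveChain_cons_cons]
    exact Finsupp.support_add.trans (Finset.union_subset
      (Finsupp.support_single_subset.trans (by simpa using h.1)) (support_curveChain_subset h.2))

open Classical in
lemma curveChain_apply {V : Type*} (e : V × V) :
    ∀ {l : List V}, l.Nodup → curveChain l e = if e ∈ l.zip l.tail then 1 else 0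
  | [], _ => by simp [curveChain]
  | [a], _ => by simp [curveChain]
  | a :: b :: l, h => by
    have ih := curveChain_apply e (l := b :: l) (List.nodup_cons.1 h).2
    rw [curveChain_cons_cons, Finsupp.add_apply, ih]
    by_cases hab : (a, b) = e
    · have : e ∉ (b :: l).zip (b :: l).tail := fun h' => by
        rw [← hab] at h'
        exact (List.nodup_cons.1 h).1 (List.of_mem_zip h').1
      rw [if_neg this]
      simp [hab]
    · have : e ∈ (a :: b :: l).zip (a :: b :: l).tail ↔ e ∈ (b :: l).zip (b :: l).tail := by
        simp [Ne.symm hab]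
      rw [Finsupp.single_eq_of_ne (Ne.symm hab), zero_add]
      simp only [this]

/-- In a graph without cycles, all curves between two given points run through the same edges. -/
lemma WeightedDigraph.NoCycles.edgeOnCurve_iff {G : WeightedDigraph d} (hG : G.NoCycles)
    {u v : EuclideanSpace ℝ (Fin d)} {l : List (EuclideanSpace ℝ (Fin d))} (hl : G.IsCurve u v l)
    (e : EuclideanSpace ℝ (Fin d) × EuclideanSpace ℝ (Fin d)) :
    G.EdgeOnCurve u v e ↔ e ∈ l.zip l.tail := by
  classical
  refine ⟨?_, fun h => ⟨l, hl, h⟩⟩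
  rintro ⟨l', hl', he⟩
  have h := hG.cycleFree (curveChain l' - curveChain l)
    (Finsupp.support_sub.trans (Finset.union_subset (support_curveChain_subset hl'.2.2.2.2)
      (support_curveChain_subset hl.2.2.2.2)))
    (fun φ => by rw [map_sub, flux_curveChain φ hl'.1 hl'.2.1, flux_curveChain φ hl.1 hl.2.1,
      sub_self])
  have h' := DFunLike.congr_fun h e
  rw [Finsupp.sub_apply, curveChain_apply e hl'.2.2.1, curveChain_apply e hl.2.2.1, if_pos he] at h'
  by_contra hne
  simp [hne] at h'

/-- The edge weights of a weighted directed graph as a `1`-chain. -/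
noncomputable def WeightedDigraph.toChain (G : WeightedDigraph d) :
    EuclideanSpace ℝ (Fin d) × EuclideanSpace ℝ (Fin d) →₀ ℝ :=
  ∑ e ∈ G.edges, Finsupp.single e (G.weight e)

open Classical in
lemma WeightedDigraph.toChain_apply (G : WeightedDigraph d)
    (e : EuclideanSpace ℝ (Fin d) × EuclideanSpace ℝ (Fin d)) :
    G.toChain e = if e ∈ G.edges then G.weight e else 0 := by
  simp [toChain, Finsupp.finsetSum_apply, Finsupp.single_apply]

lemma WeightedDigraph.support_toChain (G : WeightedDigraph d) : G.toChain.support = G.edges := by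
  classical
  ext e
  by_cases he : e ∈ G.edges
  · simp [toChain_apply, he, (G.weight_pos e he).ne']
  · simp [toChain_apply, he]

lemma WeightedDigraph.toChain_nonneg (G : WeightedDigraph d)
    (e : EuclideanSpace ℝ (Fin d) × EuclideanSpace ℝ (Fin d)) : 0 ≤ G.toChain e := by
  classical
  rw [toChain_apply]
  split_ifs with h
  exacts [(G.weight_pos e h).le, le_rfl]

/-- On a graph without cycles the plan determines the chain: a plan with the right marginals that
ships along directed curves only is compatible with the graph, since the chain
`∑ i j, q i j • g i j` has the same boundary as `G`. -/
lemma WeightedDigraph.NoCycles.compatible {k ℓ : ℕ} {G : WeightedDigraph d} (hG : G.NoCycles)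
    {x : Fin k → EuclideanSpace ℝ (Fin d)} {y : Fin ℓ → EuclideanSpace ℝ (Fin d)}
    {m : Fin k → ℝ} {n : Fin ℓ → ℝ} {q : Fin k → Fin ℓ → ℝ}
    (hflux : ∀ φ, flux φ G.toChain = ∑ j, n j * φ (y j) - ∑ i, m i * φ (x i))
    (hqm : ∀ i, ∑ j, q i j = m i) (hqn : ∀ j, ∑ i, q i j = n j)
    (hq : ∀ i j, q i j ≠ 0 → ∃ l, G.IsCurve (x i) (y j) l) : Compatible x y G q := by
  classical
  refine ⟨fun i j h => by_contra fun h' => h (hq i j h'), fun e he => ?_⟩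
  have hl : ∀ i j, ∃ l, q i j ≠ 0 → G.IsCurve (x i) (y j) l := fun i j => by
    by_cases h : q i j = 0
    · exact ⟨[], fun h' => absurd h h'⟩
    · exact (hq i j h).imp fun _ h' _ => h'
  choose l hl using hl
  have h := hG.cycleFree (G.toChain - ∑ i, ∑ j, q i j • curveChain (l i j)) (by
      refine Finsupp.support_sub.trans (Finset.union_subset G.support_toChain.subset ?_)
      refine (Finsupp.support_finsetSum).trans (Finset.biUnion_subset.2 fun i _ => ?_)
      refine (Finsupp.support_finsetSum).trans (Finset.biUnion_subset.2 fun j _ => ?_)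
      by_cases h : q i j = 0
      · simp [h]
      · exact Finsupp.support_smul.trans (support_curveChain_subset (hl i j h).2.2.2.2))
    (fun φ => by
      have h1 : ∀ i j, q i j * flux φ (curveChain (l i j)) = q i j * (φ (y j) - φ (x i)) := by
        intro i j
        by_cases h : q i j = 0
        · simp [h]
        · rw [flux_curveChain φ (hl i j h).1 (hl i j h).2.1]
      simp only [map_sub, map_sum, map_smul, smul_eq_mul, h1, hflux, mul_sub,
        Finset.sum_sub_distrib]
      rw [Finset.sum_comm]
      simp only [← Finset.sum_mul, hqn, hqm, sub_self])
  have h' := DFunLike.congr_fun h e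
  rw [Finsupp.sub_apply, Finsupp.zero_apply, sub_eq_zero, WeightedDigraph.toChain_apply, if_pos he,
    Finsupp.finsetSum_apply] at h'
  rw [h']
  refine Finset.sum_congr rfl fun i _ => ?_
  rw [Finsupp.finsetSum_apply]
  refine Finset.sum_congr rfl fun j _ => ?_
  by_cases h : q i j = 0
  · simp [h]
  · rw [Finsupp.smul_apply, curveChain_apply e (hl i j h).2.2.1, hG.edgeOnCurve_iff (hl i j h)]
    simp

end Graphs

/-! ### The cost of a chain and reduction of the number of edges -/

section Cost

/-- The `M_α` cost of a `1`-chain with nonnegative coefficients. -/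
noncomputable def chainCost {V : Type*} [PseudoMetricSpace V] (α : ℝ) (w : V × V →₀ ℝ) : ℝ :=
  w.sum fun e a => a ^ α * dist e.1 e.2

variable {V : Type*}

section Metric

variable [PseudoMetricSpace V] {α : ℝ}

open Classical in
/-- The case distinction matters for `α = 0`, where `0 ^ α = 1`. -/
lemma chainCost_eq_sum (α : ℝ) {w : V × V →₀ ℝ} {S : Finset (V × V)} (h : w.support ⊆ S) :
    chainCost α w = ∑ e ∈ S, (if w e = 0 then 0 else w e ^ α) * dist e.1 e.2 := by
  rw [chainCost, Finsupp.sum, ← Finset.sum_subset h fun e _ he => by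
    simp [Finsupp.notMem_support_iff.1 he]]
  exact Finset.sum_congr rfl fun e he => by simp [Finsupp.mem_support_iff.1 he]

lemma chainCost_le_sum (α : ℝ) {w : V × V →₀ ℝ} (hw : ∀ e, 0 ≤ w e) {S : Finset (V × V)}
    (h : w.support ⊆ S) : chainCost α w ≤ ∑ e ∈ S, w e ^ α * dist e.1 e.2 :=
  Finset.sum_le_sum_of_subset_of_nonneg h fun e _ _ =>
    mul_nonneg (Real.rpow_nonneg (hw e) α) dist_nonneg

lemma chainCost_single_le (α : ℝ) (e : V × V) {a : ℝ} (ha : 0 ≤ a) :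
    chainCost α (Finsupp.single e a) ≤ a ^ α * dist e.1 e.2 := by
  refine (chainCost_le_sum α (fun e' => Finsupp.single_nonneg.2 ha e')
    Finsupp.support_single_subset).trans ?_
  simp

lemma chainCost_add_le (hα0 : 0 ≤ α) (hα1 : α ≤ 1) {w z : V × V →₀ ℝ} (hw : ∀ e, 0 ≤ w e)
    (hz : ∀ e, 0 ≤ z e) : chainCost α (w + z) ≤ chainCost α w + chainCost α z := by
  classical
  rw [chainCost_eq_sum α Finsupp.support_add,
    chainCost_eq_sum α (S := w.support ∪ z.support) Finset.subset_union_left,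
    chainCost_eq_sum α (S := w.support ∪ z.support) (w := z) Finset.subset_union_right,
    ← Finset.sum_add_distrib]
  refine Finset.sum_le_sum fun e _ => ?_
  rw [← add_mul]
  refine mul_le_mul_of_nonneg_right ?_ dist_nonneg
  by_cases h1 : w e = 0
  · simp [h1]
  by_cases h2 : z e = 0
  · simp [h2]
  have : w e + z e ≠ 0 := by
    have := (hw e).lt_of_ne' h1
    have := hz e
    positivity
  simp only [Finsupp.add_apply, this, h1, h2, if_false]
  exact Real.rpow_add_le_add_rpow (hw e) (hz e) hα0 hα1

lemma chainCost_sum_single_le (hα0 : 0 ≤ α) (hα1 : α ≤ 1) {ι : Type*} (s : Finset ι)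
    (p : ι → V × V) {c : ι → ℝ} (hc : ∀ i, 0 ≤ c i) :
    chainCost α (∑ i ∈ s, Finsupp.single (p i) (c i)) ≤
      ∑ i ∈ s, c i ^ α * dist (p i).1 (p i).2 := by
  classical
  induction s using Finset.induction_on with
  | empty => simp [chainCost]
  | insert i s hi ih =>
    rw [Finset.sum_insert hi, Finset.sum_insert hi]
    refine (chainCost_add_le hα0 hα1 (fun e => Finsupp.single_nonneg.2 (hc i) e) fun e => ?_).trans
      (add_le_add (chainCost_single_le α _ (hc i)) ih)
    rw [Finsupp.finsetSum_apply]
    exact Finset.sum_nonneg fun j _ => Finsupp.single_nonneg.2 (hc j) e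

/-- The tangent line inequality for the concave function `t ↦ t ^ α`. -/
lemma rpow_sub_le_tangent (hα0 : 0 ≤ α) (hα1 : α ≤ 1) {a s : ℝ} (ha : 0 < a) (hs : 0 ≤ a - s) :
    (a - s) ^ α ≤ a ^ α - a ^ α * (α / a) * s := by
  have h1 : a - s = a * (1 + -s / a) := by field_simp; ring
  have h2 : -1 ≤ -s / a := by
    rw [le_div_iff₀ ha]; linarith
  rw [h1, Real.mul_rpow ha.le (by linarith)]
  calc a ^ α * (1 + -s / a) ^ α ≤ a ^ α * (1 + α * (-s / a)) :=
        mul_le_mul_of_nonneg_left (rpow_one_add_le_one_add_mul_self h2 hα0 hα1)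
          (Real.rpow_nonneg ha.le α)
    _ = a ^ α - a ^ α * (α / a) * s := by field_simp; ring

/-- A cycle in the support of a chain can be used to empty an edge: by concavity of the cost, one
of the two directions in which the cycle may be added does not increase it. -/
lemma exists_smaller_of_cycle (hα0 : 0 ≤ α) (hα1 : α ≤ 1) {w z : V × V →₀ ℝ}
    (hw : ∀ e, 0 ≤ w e) (hz : z.support ⊆ w.support) (hz0 : z ≠ 0)
    (hflux : ∀ φ : V → ℝ, flux φ z = 0) :
    ∃ w' : V × V →₀ ℝ, (∀ e, 0 ≤ w' e) ∧ w'.support ⊂ w.support ∧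
      (∀ φ : V → ℝ, flux φ w' = flux φ w) ∧ chainCost α w' ≤ chainCost α w := by
  -- the derivative of the cost at `w` in the direction `z`
  let D : (V × V →₀ ℝ) → ℝ := fun z =>
    ∑ e ∈ w.support, w e ^ α * (α / w e) * z e * dist e.1 e.2
  have key : ∀ z : V × V →₀ ℝ, z.support ⊆ w.support → (∀ φ : V → ℝ, flux φ z = 0) →
      0 ≤ D z → (∃ e, 0 < z e) → ∃ w' : V × V →₀ ℝ, (∀ e, 0 ≤ w' e) ∧ w'.support ⊂ w.support ∧
      (∀ φ : V → ℝ, flux φ w' = flux φ w) ∧ chainCost α w' ≤ chainCost α w := by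
    intro z hz hflux hD hpos
    obtain ⟨t, ht0, htw, hts⟩ := exists_sub_smul_nonneg hw hz hpos
    refine ⟨w - t • z, htw, hts, fun φ => by simp [hflux], ?_⟩
    have h1 : chainCost α (w - t • z) ≤ chainCost α w - t * D z := by
      refine (chainCost_le_sum α htw hts.1).trans ?_
      rw [chainCost, Finsupp.sum, Finset.mul_sum, ← Finset.sum_sub_distrib]
      refine Finset.sum_le_sum fun e he => ?_
      have h2 := rpow_sub_le_tangent hα0 hα1
        ((hw e).lt_of_ne' (Finsupp.mem_support_iff.1 he)) (s := t * z e) (by simpa using htw e)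
      have h3 := mul_le_mul_of_nonneg_right h2 (dist_nonneg (x := e.1) (y := e.2))
      simp only [Finsupp.coe_sub, Finsupp.coe_smul, Pi.sub_apply, Pi.smul_apply, smul_eq_mul]
      linarith
    have := mul_nonneg ht0.le hD
    linarith
  have hneg : D (-z) = -D z := by simp [D, ← Finset.sum_neg_distrib]
  have hzn : (-z).support ⊆ w.support := by rwa [Finsupp.support_neg]
  have hposD : ∀ z : V × V →₀ ℝ, 0 < D z → ∃ e, 0 < z e := fun z hD => by
    by_contra! hcon
    refine hD.not_ge (Finset.sum_nonpos fun e _ => ?_)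
    refine mul_nonpos_of_nonpos_of_nonneg (mul_nonpos_of_nonneg_of_nonpos ?_ (hcon e)) dist_nonneg
    exact mul_nonneg (Real.rpow_nonneg (hw e) α) (div_nonneg hα0 (hw e))
  have hfluxn : ∀ φ : V → ℝ, flux φ (-z) = 0 := fun φ => by simp [hflux]
  rcases lt_trichotomy (D z) 0 with hD | hD | hD
  · exact key (-z) hzn hfluxn (by linarith) (hposD _ (by linarith))
  · obtain ⟨e, he⟩ := Finsupp.ne_iff.1 hz0
    rcases lt_or_gt_of_ne he with h | h
    · exact key (-z) hzn hfluxn (by linarith) ⟨e, by simpa using h⟩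
    · exact key z hz hflux hD.ge ⟨e, h⟩
  · exact key z hz hflux hD.le (hposD z hD)

/-- Two consecutive edges of equal weight may be replaced by one: the boundary stays the same, and
the cost does not increase, by the triangle inequality. -/
lemma exists_smaller_of_consecutive (hα0 : 0 ≤ α) (hα1 : α ≤ 1) {w : V × V →₀ ℝ}
    (hw : ∀ e, 0 ≤ w e) {u v u' : V} (hne : (u, v) ≠ (v, u')) (h₁ : w (u, v) ≠ 0)
    (heq : w (u, v) = w (v, u')) :
    ∃ w' : V × V →₀ ℝ, (∀ e, 0 ≤ w' e) ∧ w'.support.card < w.support.card ∧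
      (∀ e ∈ w'.support, e ∈ w.support ∨ e = (u, u')) ∧
      (∀ φ : V → ℝ, flux φ w' = flux φ w) ∧ chainCost α w' ≤ chainCost α w := by
  classical
  set a := w (u, v) with ha
  set w₀ := (w.erase (u, v)).erase (v, u') with hw₀
  have ha0 : 0 ≤ a := hw _
  have hdec : w = w₀ + Finsupp.single (u, v) a + Finsupp.single (v, u') a := by
    ext e
    by_cases h1 : e = (u, v)
    · subst h1
      simp [hw₀, ha, hne, Finsupp.erase_ne hne]
    · by_cases h2 : e = (v, u')
      · subst h2
        simp [hw₀, heq, Ne.symm hne]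
      · simp [hw₀, Finsupp.erase_ne h2, Finsupp.erase_ne h1, h1, h2]
  have hw₀0 : ∀ e, 0 ≤ w₀ e := fun e => by
    simp only [hw₀, Finsupp.erase_apply]
    split_ifs
    exacts [le_rfl, le_rfl, hw e]
  have hsupp : w₀.support = (w.support.erase (u, v)).erase (v, u') := by
    simp [hw₀, Finsupp.support_erase]
  have hm1 : (u, v) ∈ w.support := Finsupp.mem_support_iff.2 h₁
  have hm2 : (v, u') ∈ w.support.erase (u, v) :=
    Finset.mem_erase.2 ⟨hne.symm, Finsupp.mem_support_iff.2 (heq ▸ h₁)⟩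
  refine ⟨w₀ + Finsupp.single (u, u') a, fun e => ?_, ?_, fun e he => ?_, fun φ => ?_, ?_⟩
  · exact add_nonneg (hw₀0 e) (Finsupp.single_nonneg.2 ha0 e)
  · have h1 := Finset.card_le_card (Finsupp.support_add (g₁ := w₀) (g₂ := Finsupp.single (u, u') a))
    have h2 := Finset.card_union_le w₀.support (Finsupp.single (u, u') a).support
    have h3 := Finset.card_le_card (Finsupp.support_single_subset (a := (u, u')) (b := a))
    have h4 : w₀.support.card = w.support.card - 1 - 1 := by
      rw [hsupp, Finset.card_erase_of_mem hm2, Finset.card_erase_of_mem hm1]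
    have h5 := Finset.card_pos.2 ⟨_, hm2⟩
    rw [Finset.card_erase_of_mem hm1] at h5
    rw [Finset.card_singleton] at h3
    omega
  · rcases Finset.mem_union.1 (Finsupp.support_add he) with h | h
    · rw [hsupp] at h
      exact Or.inl (Finset.mem_of_mem_erase (Finset.mem_of_mem_erase h))
    · exact Or.inr (by simpa using Finsupp.support_single_subset h)
  · rw [hdec]
    simp only [map_add, flux_single]
    ring
  · have h1 : chainCost α w = chainCost α w₀ + a ^ α * dist u v + a ^ α * dist v u' := by
      rw [chainCost, chainCost, Finsupp.sum, Finsupp.sum, ← Finset.add_sum_erase _ _ hm1,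
        ← Finset.add_sum_erase _ _ hm2, hsupp]
      have : ∑ e ∈ (w.support.erase (u, v)).erase (v, u'), w₀ e ^ α * dist e.1 e.2 =
          ∑ e ∈ (w.support.erase (u, v)).erase (v, u'), w e ^ α * dist e.1 e.2 := by
        refine Finset.sum_congr rfl fun e he => ?_
        rw [hw₀, Finsupp.erase_ne (Finset.ne_of_mem_erase he),
          Finsupp.erase_ne (Finset.ne_of_mem_erase (Finset.mem_of_mem_erase he))]
      rw [this, ← heq]
      ring
    have h2 := chainCost_add_le hα0 hα1 hw₀0
      (z := Finsupp.single (u, u') a) (fun e => Finsupp.single_nonneg.2 ha0 e)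
    have h3 := chainCost_single_le α (u, u') ha0
    have h4 := mul_le_mul_of_nonneg_left (dist_triangle u v u') (Real.rpow_nonneg ha0 α)
    simp only at h3
    linarith

end Metric

section Counting

/-- The boundary of a chain is determined by its coefficients at the vertices in `T`, the fluxes against
the indicator functions of points. -/
lemma flux_eq_sum_single [DecidableEq V] (φ : V → ℝ) {c : V × V →₀ ℝ} {T : Finset V}
    (hT : ∀ e ∈ c.support, e.1 ∈ T ∧ e.2 ∈ T) :
    flux φ c = ∑ v ∈ T, φ v * flux (Pi.single v 1) c := by
  simp only [flux_eq_sum _ (subset_refl c.support), Finset.mul_sum]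
  rw [Finset.sum_comm]
  refine Finset.sum_congr rfl fun e he => ?_
  obtain ⟨h1, h2⟩ := hT e he
  have h : ∀ p ∈ T, ∑ v ∈ T, φ v * (Pi.single v 1 : V → ℝ) p = φ p := fun p hp => by
    simp [Pi.single_apply, hp]
  rw [← h _ h1, ← h _ h2, ← Finset.sum_sub_distrib, Finset.mul_sum]
  exact Finset.sum_congr rfl fun v _ => by ring

/-- The boundary map is injective on the chains on a set of edges without cycles, so there are at
most as many edges as vertices. -/
lemma CycleFree.card_le {S : Finset (V × V)} (hS : CycleFree S) {T : Finset V}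
    (hT : ∀ e ∈ S, e.1 ∈ T ∧ e.2 ∈ T) : S.card ≤ T.card := by
  classical
  let L : (S →₀ ℝ) →ₗ[ℝ] (T → ℝ) :=
    (LinearMap.pi fun v : T => flux (Pi.single (v : V) 1)) ∘ₗ
      Finsupp.lmapDomain ℝ ℝ (Subtype.val : S → V × V)
  have hL : Function.Injective L := by
    rw [← LinearMap.ker_eq_bot, LinearMap.ker_eq_bot']
    intro z hz
    have hsupp : (Finsupp.mapDomain (Subtype.val : S → V × V) z).support ⊆ S := by
      refine Finsupp.mapDomain_support.trans fun e he => ?_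
      obtain ⟨e', -, rfl⟩ := Finset.mem_image.1 he
      exact e'.2
    have h0 := hS _ hsupp fun φ => by
      rw [flux_eq_sum_single φ fun e he => hT e (hsupp he)]
      refine Finset.sum_eq_zero fun v hv => ?_
      have : flux (Pi.single v 1) (Finsupp.mapDomain (Subtype.val : S → V × V) z) = 0 :=
        congrFun hz ⟨v, hv⟩
      rw [this, mul_zero]
    exact Finsupp.mapDomain_injective Subtype.val_injective (h0.trans Finsupp.mapDomain_zero.symm)
  simpa using LinearMap.finrank_le_finrank_of_injective hL

open Classical in
/-- If all vertices outside `A` have degree at least three, then a set of edges without cycles has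
at most `3 * |A|` elements. -/
lemma CycleFree.card_le_three_mul {S : Finset (V × V)} (hS : CycleFree S) {A : Finset V}
    (hA : ∀ v ∉ A, (S.filter fun e => e.1 = v ∨ e.2 = v).Nonempty →
      3 ≤ (S.filter fun e => e.1 = v ∨ e.2 = v).card) :
    S.card ≤ 3 * A.card := by
  set T : Finset V := S.image Prod.fst ∪ S.image Prod.snd with hT
  have hTS : ∀ e ∈ S, e.1 ∈ T ∧ e.2 ∈ T := fun e he =>
    ⟨Finset.mem_union_left _ (Finset.mem_image_of_mem _ he),
      Finset.mem_union_right _ (Finset.mem_image_of_mem _ he)⟩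
  have h1 := hS.card_le hTS
  have h2 : ∑ v ∈ T \ A, (S.filter fun e => e.1 = v ∨ e.2 = v).card =
      ∑ e ∈ S, ((T \ A).filter fun v => e.1 = v ∨ e.2 = v).card :=
    Finset.sum_card_bipartiteAbove_eq_sum_card_bipartiteBelow fun v (e : V × V) => e.1 = v ∨ e.2 = v
  have h3 : (T \ A).card * 3 ≤ ∑ v ∈ T \ A, (S.filter fun e => e.1 = v ∨ e.2 = v).card := by
    refine Finset.card_nsmul_le_sum _ _ _ fun v hv => hA v (Finset.mem_sdiff.1 hv).2 ?_
    rcases Finset.mem_union.1 (Finset.mem_sdiff.1 hv).1 with h | h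
    · obtain ⟨e, he, rfl⟩ := Finset.mem_image.1 h
      exact ⟨e, by simp [he]⟩
    · obtain ⟨e, he, rfl⟩ := Finset.mem_image.1 h
      exact ⟨e, by simp [he]⟩
  have h4 : ∑ e ∈ S, ((T \ A).filter fun v => e.1 = v ∨ e.2 = v).card ≤ S.card * 2 := by
    refine Finset.sum_le_card_nsmul _ _ _ fun e _ => ?_
    refine (Finset.card_le_card (t := {e.1, e.2}) fun v hv => ?_).trans Finset.card_le_two
    rcases (Finset.mem_filter.1 hv).2 with h | h <;> simp [h]
  have h5 : T.card ≤ (T \ A).card + A.card := by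
    have := Finset.le_card_sdiff A T
    omega
  omega

end Counting

/-- Every chain with boundary supported in `A` can be replaced, without increasing the cost or
changing the boundary, by one without cycles and with a number of edges bounded in terms of `A`:
in a chain of minimal support, a vertex outside `A` has at least three edges, since one with fewer
has an incoming and an outgoing edge of the same weight. -/
lemma exists_reduced [PseudoMetricSpace V] {α : ℝ} (hα0 : 0 ≤ α) (hα1 : α ≤ 1) {A : Finset V}
    {X : Set V} (w : V × V →₀ ℝ) (hw : ∀ e, 0 ≤ w e) (hX : ∀ e ∈ w.support, e.1 ∈ X ∧ e.2 ∈ X)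
    (hA : ∀ φ : V → ℝ, (∀ v ∈ A, φ v = 0) → flux φ w = 0) :
    ∃ w' : V × V →₀ ℝ, (∀ e, 0 ≤ w' e) ∧ (∀ e ∈ w'.support, e.1 ∈ X ∧ e.2 ∈ X) ∧
      (∀ φ : V → ℝ, flux φ w' = flux φ w) ∧ chainCost α w' ≤ chainCost α w ∧
      CycleFree w'.support ∧ w'.support.card ≤ 3 * A.card := by
  classical
  induction hN : w.support.card using Nat.strong_induction_on generalizing w with
  | _ N IH =>
    -- it suffices to find a chain with fewer edges that is as good as `w`
    have step : ∀ w₁ : V × V →₀ ℝ, (∀ e, 0 ≤ w₁ e) → w₁.support.card < w.support.card →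
        (∀ e ∈ w₁.support, e.1 ∈ X ∧ e.2 ∈ X) → (∀ φ : V → ℝ, flux φ w₁ = flux φ w) →
        chainCost α w₁ ≤ chainCost α w →
        ∃ w' : V × V →₀ ℝ, (∀ e, 0 ≤ w' e) ∧ (∀ e ∈ w'.support, e.1 ∈ X ∧ e.2 ∈ X) ∧
          (∀ φ : V → ℝ, flux φ w' = flux φ w) ∧ chainCost α w' ≤ chainCost α w ∧
          CycleFree w'.support ∧ w'.support.card ≤ 3 * A.card := fun w₁ h1 h2 h3 h4 h5 => by
      obtain ⟨w', a1, a2, a3, a4, a5⟩ := IH _ (hN ▸ h2) w₁ h1 h3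
        (fun φ hφ => by rw [h4, hA φ hφ]) rfl
      exact ⟨w', a1, a2, fun φ => (a3 φ).trans (h4 φ), a4.trans h5, a5⟩
    by_cases hS : CycleFree w.support
    swap
    · rw [CycleFree] at hS
      push Not at hS
      obtain ⟨z, hz, hflux, hz0⟩ := hS
      obtain ⟨w₁, h1, h2, h3, h4⟩ := exists_smaller_of_cycle hα0 hα1 hw hz hz0 hflux
      exact step w₁ h1 (Finset.card_lt_card h2) (fun e he => hX e (h2.1 he)) h3 h4
    by_cases hdeg : ∀ v ∉ A, (w.support.filter fun e => e.1 = v ∨ e.2 = v).Nonempty →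
      3 ≤ (w.support.filter fun e => e.1 = v ∨ e.2 = v).card
    · exact ⟨w, hw, hX, fun _ => rfl, le_rfl, hS, hS.card_le_three_mul hdeg⟩
    push Not at hdeg
    obtain ⟨v, hvA, ⟨e, he⟩, hcard⟩ := hdeg
    set I := w.support.filter fun e => e.1 = v ∨ e.2 = v with hI
    have hpos : ∀ e ∈ w.support, 0 < w e := fun e he =>
      (hw e).lt_of_ne' (Finsupp.mem_support_iff.1 he)
    -- the balance equation at `v`
    have hbal : ∑ e ∈ I, w e * ((if e.2 = v then 1 else 0) - if e.1 = v then 1 else 0) = 0 := by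
      have := hA (fun p => if p = v then 1 else 0) fun p hp => by
        have h : p ≠ v := fun h => hvA (h ▸ hp)
        simp [h]
      rw [flux_eq_sum _ (subset_refl w.support)] at this
      rw [hI, Finset.sum_filter_of_ne, this]
      intro e _ h
      by_contra! h'
      simp [h'.1, h'.2] at h
    obtain ⟨e₁, he₁, h₁⟩ : ∃ e ∈ I, e.2 = v := by
      by_contra! hcon
      refine (Finset.sum_neg (s := I) (fun e he => ?_) ⟨e, he⟩).ne hbal
      have h := hcon e he
      have he' := Finset.mem_filter.1 he
      simp [h, he'.2.resolve_right h, hpos e he'.1]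
    obtain ⟨e₂, he₂, h₂⟩ : ∃ e ∈ I, e.1 = v := by
      by_contra! hcon
      refine (Finset.sum_pos (s := I) (fun e he => ?_) ⟨e, he⟩).ne' hbal
      have h := hcon e he
      have he' := Finset.mem_filter.1 he
      simp [h, he'.2.resolve_left h, hpos e he'.1]
    have hs₁ := (Finset.mem_filter.1 he₁).1
    have hs₂ := (Finset.mem_filter.1 he₂).1
    have h₁' : e₁.1 ≠ v := h₁ ▸ hS.fst_ne_snd hs₁
    have h₂' : e₂.2 ≠ v := h₂ ▸ (hS.fst_ne_snd hs₂).symm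
    have hne : e₁ ≠ e₂ := fun h => h₁' (h ▸ h₂)
    have hIeq : I = {e₁, e₂} := by
      refine (Finset.eq_of_subset_of_card_le (fun e he => ?_) ?_).symm
      · rcases Finset.mem_insert.1 he with rfl | he
        · exact he₁
        · exact Finset.mem_singleton.1 he ▸ he₂
      · rw [Finset.card_pair hne]; omega
    rw [hIeq, Finset.sum_pair hne] at hbal
    simp only [h₁, h₂, h₁', h₂', if_true, if_false] at hbal
    obtain ⟨u, v₁⟩ := e₁
    obtain ⟨v₂, u'⟩ := e₂
    obtain rfl : v₁ = v := h₁
    obtain rfl : v₂ = v₁ := h₂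
    obtain ⟨w₁, a1, a2, a3, a4, a5⟩ := exists_smaller_of_consecutive hα0 hα1 hw hne
      (hpos _ hs₁).ne' (by linarith)
    refine step w₁ a1 a2 (fun e he => ?_) a4 a5
    rcases a3 e he with h | rfl
    · exact hX e h
    · exact ⟨(hX _ hs₁).1, (hX _ hs₂).2⟩

end Cost

/-! ### Transport paths as chains -/

section Transport

variable {d k ℓ : ℕ}

open Classical in
lemma atomicMeasure_real_singleton {s : ℕ} (z : Fin s → EuclideanSpace ℝ (Fin d)) {c : Fin s → ℝ}
    (hc : ∀ i, 0 ≤ c i) (v : EuclideanSpace ℝ (Fin d)) :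
    (atomicMeasure z c).real {v} = ∑ i, if z i = v then c i else 0 := by
  rw [Measure.real, atomicMeasure, Measure.coe_finsetSum, Finset.sum_apply, ENNReal.toReal_sum]
  · refine Finset.sum_congr rfl fun i _ => ?_
    by_cases h : z i = v <;> simp [h, hc i]
  · intro i _
    by_cases h : z i = v <;> simp [h]

lemma atomicMeasure_singleton_ne_zero {s : ℕ} {z : Fin s → EuclideanSpace ℝ (Fin d)}
    {c : Fin s → ℝ} {v : EuclideanSpace ℝ (Fin d)} (h : atomicMeasure z c {v} ≠ 0) :
    ∃ i, z i = v := by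
  by_contra! hcon
  exact h (by simp [atomicMeasure, Measure.coe_finsetSum, hcon])

lemma atomicMeasure_singleton_ne_zero_of_pos {s : ℕ} (z : Fin s → EuclideanSpace ℝ (Fin d))
    {c : Fin s → ℝ} {i : Fin s} (h : 0 < c i) : atomicMeasure z c {z i} ≠ 0 := by
  intro h0
  rw [atomicMeasure, Measure.coe_finsetSum, Finset.sum_apply, Finset.sum_eq_zero_iff] at h0
  have := h0 i (Finset.mem_univ i)
  simp at this
  linarith

lemma WeightedDigraph.flux_toChain_single [DecidableEq (EuclideanSpace ℝ (Fin d))]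
    (G : WeightedDigraph d) (v : EuclideanSpace ℝ (Fin d)) :
    flux (Pi.single v 1) G.toChain = G.inFlow v - G.outFlow v := by
  rw [flux_eq_sum _ G.support_toChain.subset, inFlow, outFlow, Finset.sum_filter,
    Finset.sum_filter, ← Finset.sum_sub_distrib]
  refine Finset.sum_congr rfl fun e he => ?_
  rw [toChain_apply, if_pos he]
  by_cases h1 : e.1 = v <;> by_cases h2 : e.2 = v <;> simp [h1, h2]

lemma WeightedDigraph.chainCost_toChain (α : ℝ) (G : WeightedDigraph d) :
    chainCost α G.toChain = G.cost α := by
  rw [chainCost, Finsupp.sum, G.support_toChain, cost]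
  refine Finset.sum_congr rfl fun e he => ?_
  rw [toChain_apply, if_pos he]

/-- The chain `w` in `X`, with nonnegative coefficients, carries the production `m` at the points `x`
to the consumption `n` at the points `y`: its boundary is `∑ j, n j • [y j] - ∑ i, m i • [x i]`. -/
structure Carries (X : Set (EuclideanSpace ℝ (Fin d))) (x : Fin k → EuclideanSpace ℝ (Fin d))
    (m : Fin k → ℝ) (y : Fin ℓ → EuclideanSpace ℝ (Fin d)) (n : Fin ℓ → ℝ)
    (w : EuclideanSpace ℝ (Fin d) × EuclideanSpace ℝ (Fin d) →₀ ℝ) : Prop where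
  nonneg : ∀ e, 0 ≤ w e
  mem : ∀ e ∈ w.support, e.1 ∈ X ∧ e.2 ∈ X
  flux_eq : ∀ φ : EuclideanSpace ℝ (Fin d) → ℝ,
    flux φ w = ∑ j, n j * φ (y j) - ∑ i, m i * φ (x i)

variable {X : Set (EuclideanSpace ℝ (Fin d))} {x : Fin k → EuclideanSpace ℝ (Fin d)}
  {m : Fin k → ℝ} {y : Fin ℓ → EuclideanSpace ℝ (Fin d)} {n : Fin ℓ → ℝ}

lemma carries_toChain (hm : ∀ i, 0 ≤ m i) (hn : ∀ j, 0 ≤ n j) {G : WeightedDigraph d}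
    (hG : G ∈ transportPaths X (atomicMeasure x m) (atomicMeasure y n)) :
    Carries X x m y n G.toChain := by
  classical
  obtain ⟨hX, hatoms, hbal, -⟩ := hG
  refine ⟨G.toChain_nonneg, fun e he => ?_, fun φ => ?_⟩
  · rw [G.support_toChain] at he
    exact ⟨hX _ (G.fst_mem e he), hX _ (G.snd_mem e he)⟩
  have hsum : ∀ {s : ℕ} (z : Fin s → EuclideanSpace ℝ (Fin d)) (c : Fin s → ℝ),
      (∀ i, 0 ≤ c i) → (∀ v, atomicMeasure z c {v} ≠ 0 → v ∈ G.verts) →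
      ∑ v ∈ G.verts, φ v * (atomicMeasure z c).real {v} = ∑ i, c i * φ (z i) := by
    intro s z c hc hverts
    simp only [atomicMeasure_real_singleton z hc, Finset.mul_sum]
    rw [Finset.sum_comm]
    refine Finset.sum_congr rfl fun i _ => ?_
    rcases (hc i).eq_or_lt' with h | h
    · simp [h]
    · have := hverts _ (atomicMeasure_singleton_ne_zero_of_pos z h)
      simp [this, mul_comm]
  rw [flux_eq_sum_single φ (T := G.verts) (fun e he => by
      rw [G.support_toChain] at he
      exact ⟨G.fst_mem e he, G.snd_mem e he⟩),
    ← hsum x m hm fun v hv => hatoms v (Or.inl hv), ← hsum y n hn fun v hv => hatoms v (Or.inr hv),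
    ← Finset.sum_sub_distrib]
  refine Finset.sum_congr rfl fun v hv => ?_
  rw [G.flux_toChain_single, hbal v hv]
  ring

open Classical in
/-- The weighted directed graph of a nonnegative chain without cycles; the points of `A` are added
to the vertices. -/
noncomputable def ofChain (A : Finset (EuclideanSpace ℝ (Fin d)))
    (w : EuclideanSpace ℝ (Fin d) × EuclideanSpace ℝ (Fin d) →₀ ℝ) (hw : ∀ e, 0 ≤ w e)
    (hS : CycleFree w.support) : WeightedDigraph d where
  verts := A ∪ (w.support.image Prod.fst ∪ w.support.image Prod.snd)
  edges := w.support
  weight := w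
  fst_mem _ he := Finset.mem_union_right _
    (Finset.mem_union_left _ (Finset.mem_image_of_mem _ he))
  snd_mem _ he := Finset.mem_union_right _
    (Finset.mem_union_right _ (Finset.mem_image_of_mem _ he))
  fst_ne_snd _ he := hS.fst_ne_snd he
  weight_pos e he := (hw e).lt_of_ne' (Finsupp.mem_support_iff.1 he)

lemma toChain_ofChain (A : Finset (EuclideanSpace ℝ (Fin d)))
    {w : EuclideanSpace ℝ (Fin d) × EuclideanSpace ℝ (Fin d) →₀ ℝ} (hw : ∀ e, 0 ≤ w e)
    (hS : CycleFree w.support) : (ofChain A w hw hS).toChain = w := by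
  classical
  ext e
  rw [WeightedDigraph.toChain_apply]
  by_cases h : w e = 0 <;> simp [ofChain, h]

open Classical in
lemma ofChain_mem_transportPaths (hxX : ∀ i, x i ∈ X) (hyX : ∀ j, y j ∈ X) (hm : ∀ i, 0 ≤ m i)
    (hn : ∀ j, 0 ≤ n j) {w : EuclideanSpace ℝ (Fin d) × EuclideanSpace ℝ (Fin d) →₀ ℝ}
    (hw : Carries X x m y n w) (hS : CycleFree w.support) :
    ofChain (Finset.univ.image x ∪ Finset.univ.image y) w hw.nonneg hS ∈
      transportPaths X (atomicMeasure x m) (atomicMeasure y n) := by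
  refine ⟨fun v hv => ?_, fun v hv => ?_, fun v _ => ?_, ?_⟩
  · simp only [ofChain, Finset.mem_union, Finset.mem_image, Finset.mem_univ, true_and] at hv
    rcases hv with (⟨i, rfl⟩ | ⟨j, rfl⟩) | ⟨e, he, rfl⟩ | ⟨e, he, rfl⟩
    exacts [hxX i, hyX j, (hw.mem e he).1, (hw.mem e he).2]
  · refine Finset.mem_union_left _ ?_
    rcases hv with hv | hv
    · obtain ⟨i, rfl⟩ := atomicMeasure_singleton_ne_zero hv
      exact Finset.mem_union_left _ (Finset.mem_image_of_mem _ (Finset.mem_univ i))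
    · obtain ⟨i, rfl⟩ := atomicMeasure_singleton_ne_zero hv
      exact Finset.mem_union_right _ (Finset.mem_image_of_mem _ (Finset.mem_univ i))
  · have h := hw.flux_eq (Pi.single v 1)
    nth_rewrite 1 [← toChain_ofChain (Finset.univ.image x ∪ Finset.univ.image y) hw.nonneg hS] at h
    rw [WeightedDigraph.flux_toChain_single] at h
    rw [atomicMeasure_real_singleton x hm, atomicMeasure_real_singleton y hn]
    simp only [Pi.single_apply, mul_ite, mul_one, mul_zero] at h
    linarith
  · exact WeightedDigraph.noCycles_of_cycleFree hS

/-- On a chain without cycles no edge carries more than the total consumption, as one sees by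
cutting the edge. -/
lemma Carries.apply_le_sum (hm : ∀ i, 0 ≤ m i) (hn : ∀ j, 0 ≤ n j)
    {w : EuclideanSpace ℝ (Fin d) × EuclideanSpace ℝ (Fin d) →₀ ℝ}
    (hw : Carries X x m y n w) (hS : CycleFree w.support)
    (e : EuclideanSpace ℝ (Fin d) × EuclideanSpace ℝ (Fin d)) : w e ≤ ∑ j, n j := by
  by_cases he : w e = 0
  · rw [he]; exact Finset.sum_nonneg fun j _ => hn j
  have he' : e ∈ w.support := Finsupp.mem_support_iff.2 he
  have hG : (ofChain ∅ w hw.nonneg hS).NoCycles := WeightedDigraph.noCycles_of_cycleFree hS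
  obtain ⟨φ, hφ, h0, h1, hcut⟩ := hG.exists_cut (e := e) he'
  have h := hw.flux_eq φ
  rw [flux_eq_sum φ (subset_refl _), Finset.sum_eq_single_of_mem e he' fun e' he' hne => by
    rw [hcut e' he' hne, sub_self, mul_zero], h0, h1] at h
  have h2 : ∑ j, n j * φ (y j) ≤ ∑ j, n j :=
    Finset.sum_le_sum fun j _ => mul_le_of_le_one_right (hn j) (hφ _).2
  have h3 : 0 ≤ ∑ i, m i * φ (x i) := Finset.sum_nonneg fun i _ => mul_nonneg (hm i) (hφ _).1
  linarith

/-- Every transport path from the production `m` to the consumption `n` is compatible with some plan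
whose production is `m`. -/
lemma exists_mem_compatiblePaths (hm : ∀ i, 0 ≤ m i) (hn : ∀ j, 0 < n j) {G : WeightedDigraph d}
    (hG : G ∈ transportPaths X (atomicMeasure x m) (atomicMeasure y n)) :
    ∃ q ∈ allocationPlans k n, G ∈ compatiblePaths X x y n q := by
  have hc := carries_toChain hm (fun j => (hn j).le) hG
  obtain ⟨q, hq0, hqm, hqn, hq⟩ := exists_plan x y _ G.toChain m n hc.nonneg hm
    (fun j => (hn j).le) hc.flux_eq le_rfl
  have hprod : production q = m := funext hqm
  refine ⟨q, ⟨hq0, hqn⟩, by rwa [hprod], hG.2.2.2.compatible hc.flux_eq hqm hqn fun i j h => ?_⟩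
  have hmi : 0 < m i := by
    rw [← hqm i]
    exact Finset.sum_pos' (fun j _ => hq0 i j) ⟨j, Finset.mem_univ j, (hq0 i j).lt_of_ne' h⟩
  refine WeightedDigraph.exists_isCurve
    (hG.2.1 _ (Or.inl (atomicMeasure_singleton_ne_zero_of_pos x hmi))) ?_
  simpa only [G.support_toChain] using hq i j h

/-! ### Compactness and existence of an optimal chain -/

/-- A finitely supported function with at most `M` points in its support, listed as a family indexed
by `Fin M`; the unused indices carry the value `0` at the point `o`. -/
lemma exists_fin_family {κ : Type*} (o : κ) {M : ℕ} {w : κ →₀ ℝ} (hM : w.support.card ≤ M) :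
    ∃ (p : Fin M → κ) (c : Fin M → ℝ),
      (∀ i, (p i ∈ w.support ∧ c i = w (p i)) ∨ (p i = o ∧ c i = 0)) ∧
      ∀ f : κ → ℝ → ℝ, f o 0 = 0 → ∑ i, f (p i) (c i) = ∑ e ∈ w.support, f e (w e) := by
  obtain ⟨g⟩ := Function.Embedding.nonempty_of_card_le (α := w.support) (β := Fin M)
    (by simpa using hM)
  refine ⟨Function.extend g (fun e => e.1) fun _ => o,
    Function.extend g (fun e => w e.1) fun _ => 0, fun i => ?_, fun f hf => ?_⟩
  · by_cases hi : ∃ e, g e = i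
    · obtain ⟨e, rfl⟩ := hi
      rw [g.injective.extend_apply, g.injective.extend_apply]
      exact Or.inl ⟨e.2, rfl⟩
    · rw [Function.extend_apply' _ _ _ hi, Function.extend_apply' _ _ _ hi]
      exact Or.inr ⟨rfl, rfl⟩
  · rw [← Finset.sum_coe_sort w.support fun e => f e (w e)]
    refine (Fintype.sum_of_injective g g.injective _ _ (fun i hi => ?_) fun e => ?_).symm
    · rw [Function.extend_apply' _ _ _ hi, Function.extend_apply' _ _ _ hi, hf]
    · rw [g.injective.extend_apply, g.injective.extend_apply]

lemma exists_continuous_eqOn_finset (F : Finset (EuclideanSpace ℝ (Fin d)))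
    (φ : EuclideanSpace ℝ (Fin d) → ℝ) :
    ∃ ψ : EuclideanSpace ℝ (Fin d) → ℝ, Continuous ψ ∧ ∀ v ∈ F, ψ v = φ v := by
  have : DiscreteTopology (F : Set (EuclideanSpace ℝ (Fin d))) := F.finite_toSet.instDiscreteTopology
  obtain ⟨g, hg⟩ := ContinuousMap.exists_restrict_eq F.finite_toSet.isClosed
    (⟨fun v => φ v, continuous_of_discreteTopology⟩ : C((F : Set (EuclideanSpace ℝ (Fin d))), ℝ))
  exact ⟨g, g.continuous, fun v hv => DFunLike.congr_fun hg ⟨v, hv⟩⟩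

/-- Families of `M` weighted segments in `X` together with a production vector, such that the family
carries the production to the consumption `n`. The boundary is tested against continuous functions
only, which makes this a closed condition, and allows endpoints to collide in a limit. -/
def segmentFamilies (X : Set (EuclideanSpace ℝ (Fin d))) (x : Fin k → EuclideanSpace ℝ (Fin d))
    (y : Fin ℓ → EuclideanSpace ℝ (Fin d)) (n : Fin ℓ → ℝ) (M : ℕ) :
    Set ((Fin M → EuclideanSpace ℝ (Fin d) × EuclideanSpace ℝ (Fin d)) × (Fin M → ℝ) ×
      (Fin k → ℝ)) :=
  ((Set.univ.pi fun _ => X ×ˢ X) ×ˢ (Set.univ.pi fun _ => Set.Icc 0 1) ×ˢ stdSimplex ℝ (Fin k)) ∩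
    {p | ∀ φ : EuclideanSpace ℝ (Fin d) → ℝ, Continuous φ →
      ∑ i, p.2.1 i * (φ (p.1 i).2 - φ (p.1 i).1) = ∑ j, n j * φ (y j) - ∑ i, p.2.2 i * φ (x i)}

lemma isCompact_segmentFamilies (hX : IsCompact X) (M : ℕ) :
    IsCompact (segmentFamilies X x y n M) := by
  refine IsCompact.inter_right ?_ ?_
  · exact (isCompact_univ_pi fun _ => hX.prod hX).prod
      ((isCompact_univ_pi fun _ => isCompact_Icc).prod (isCompact_stdSimplex ℝ (Fin k)))
  · simp only [Set.ofPred_forall]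
    refine isClosed_iInter fun φ => isClosed_iInter fun hφ => isClosed_eq ?_ ?_ <;> fun_prop

lemma exists_mem_segmentFamilies {o : EuclideanSpace ℝ (Fin d)} (ho : o ∈ X) (α : ℝ) {M : ℕ}
    (hm : m ∈ stdSimplex ℝ (Fin k)) (hn : ∀ j, 0 ≤ n j) (hn1 : ∑ j, n j = 1)
    {w : EuclideanSpace ℝ (Fin d) × EuclideanSpace ℝ (Fin d) →₀ ℝ}
    (hw : Carries X x m y n w) (hS : CycleFree w.support) (hM : w.support.card ≤ M) :
    ∃ p ∈ segmentFamilies X x y n M,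
      ∑ i, p.2.1 i ^ α * dist (p.1 i).1 (p.1 i).2 = chainCost α w := by
  obtain ⟨p, c, hpc, hsum⟩ := exists_fin_family (o, o) hM
  refine ⟨(p, c, m), ⟨⟨fun i _ => ?_, fun i _ => ?_, hm⟩, fun φ _ => ?_⟩, ?_⟩
  · rcases hpc i with ⟨h, -⟩ | ⟨h, -⟩
    · exact hw.mem _ h
    · dsimp only
      rw [h]
      exact ⟨ho, ho⟩
  · dsimp only
    rcases hpc i with ⟨-, h⟩ | ⟨-, h⟩ <;> rw [h]
    · exact ⟨hw.nonneg _, hn1 ▸ hw.apply_le_sum hm.1 hn hS _⟩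
    · simp
  · rw [← hw.flux_eq, flux_eq_sum φ (subset_refl _)]
    exact hsum (fun e a => a * (φ e.2 - φ e.1)) (by simp)
  · exact hsum (fun e a => a ^ α * dist e.1 e.2) (by simp)

lemma exists_carries_of_mem_segmentFamilies {α : ℝ} (hα0 : 0 ≤ α) (hα1 : α ≤ 1) {M : ℕ}
    {p : (Fin M → EuclideanSpace ℝ (Fin d) × EuclideanSpace ℝ (Fin d)) × (Fin M → ℝ) × (Fin k → ℝ)}
    (hp : p ∈ segmentFamilies X x y n M) :
    ∃ w, Carries X x p.2.2 y n w ∧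
      chainCost α w ≤ ∑ i, p.2.1 i ^ α * dist (p.1 i).1 (p.1 i).2 := by
  classical
  obtain ⟨⟨hpX, hpc, -⟩, hflux⟩ := hp
  have hc : ∀ i, 0 ≤ p.2.1 i := fun i => (hpc i trivial).1
  refine ⟨∑ i, Finsupp.single (p.1 i) (p.2.1 i), ⟨fun e => ?_, fun e he => ?_, fun φ => ?_⟩,
    chainCost_sum_single_le hα0 hα1 _ _ hc⟩
  · rw [Finsupp.finsetSum_apply]
    exact Finset.sum_nonneg fun i _ => Finsupp.single_nonneg.2 (hc i) e
  · obtain ⟨i, -, hi⟩ := Finset.mem_biUnion.1 (Finsupp.support_finsetSum he)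
    have := Finsupp.support_single_subset hi
    rw [Finset.mem_singleton] at this
    exact this ▸ hpX i trivial
  · -- only finitely many values of `φ` matter, and these are taken by a continuous function
    obtain ⟨ψ, hψ, heq⟩ := exists_continuous_eqOn_finset
      ((Finset.univ.image fun i => (p.1 i).1) ∪ (Finset.univ.image fun i => (p.1 i).2) ∪
        (Finset.univ.image x ∪ Finset.univ.image y)) φ
    have h := hflux ψ hψ
    have h1 : ∀ i, ψ (p.1 i).1 = φ (p.1 i).1 := fun i => heq _ (by simp)
    have h2 : ∀ i, ψ (p.1 i).2 = φ (p.1 i).2 := fun i => heq _ (by simp)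
    have h3 : ∀ i, ψ (x i) = φ (x i) := fun i => heq _ (by simp)
    have h4 : ∀ i, ψ (y i) = φ (y i) := fun i => heq _ (by simp)
    simp only [h1, h2, h3, h4] at h
    simpa only [map_sum, flux_single] using h

lemma Carries.exists_reduced {α : ℝ} (hα0 : 0 ≤ α) (hα1 : α ≤ 1)
    {w : EuclideanSpace ℝ (Fin d) × EuclideanSpace ℝ (Fin d) →₀ ℝ} (hw : Carries X x m y n w) :
    ∃ w', Carries X x m y n w' ∧ chainCost α w' ≤ chainCost α w ∧ CycleFree w'.support ∧
      w'.support.card ≤ 3 * (k + ℓ) := by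
  classical
  obtain ⟨w', h1, h2, h3, h4, h5, h6⟩ := RamifiedAllocation.exists_reduced hα0 hα1
    (A := Finset.univ.image x ∪ Finset.univ.image y) (X := X) w hw.nonneg hw.mem fun φ hφ => by
      have h1 : ∀ i, φ (x i) = 0 := fun i => hφ _ (by simp)
      have h2 : ∀ j, φ (y j) = 0 := fun j => hφ _ (by simp)
      simp [hw.flux_eq, h1, h2]
  refine ⟨w', ⟨h1, h2, fun φ => (h3 φ).trans (hw.flux_eq φ)⟩, h4, h5,
    h6.trans (Nat.mul_le_mul_left 3 ?_)⟩
  refine (Finset.card_union_le _ _).trans (add_le_add ?_ ?_)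
  · exact Finset.card_image_le.trans (by simp)
  · exact Finset.card_image_le.trans (by simp)

/-- The star with centre `x 0` carries the production of a single factory. -/
lemma exists_carries [NeZero k] (hxX : ∀ i, x i ∈ X) (hyX : ∀ j, y j ∈ X) (hn : ∀ j, 0 ≤ n j)
    (hn1 : ∑ j, n j = 1) : ∃ m ∈ stdSimplex ℝ (Fin k), ∃ w, Carries X x m y n w := by
  classical
  refine ⟨Pi.single 0 1, single_mem_stdSimplex ℝ 0, ∑ j, Finsupp.single (x 0, y j) (n j),
    fun e => ?_, fun e he => ?_, fun φ => ?_⟩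
  · rw [Finsupp.finsetSum_apply]
    exact Finset.sum_nonneg fun i _ => Finsupp.single_nonneg.2 (hn i) e
  · obtain ⟨j, -, hj⟩ := Finset.mem_biUnion.1 (Finsupp.support_finsetSum he)
    have := Finsupp.support_single_subset hj
    rw [Finset.mem_singleton] at this
    exact this ▸ ⟨hxX 0, hyX j⟩
  · simp [mul_sub, Finset.sum_sub_distrib, ← Finset.sum_mul, hn1, Pi.single_apply]

/-- There is a cheapest chain without cycles among all chains that carry some probability vector of
productions to `n`. -/
lemma exists_minimal_carries {α : ℝ} (hα0 : 0 ≤ α) (hα1 : α ≤ 1) (hk : 0 < k) (hX : IsCompact X)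
    (hxX : ∀ i, x i ∈ X) (hyX : ∀ j, y j ∈ X) (hn : ∀ j, 0 ≤ n j) (hn1 : ∑ j, n j = 1) :
    ∃ m ∈ stdSimplex ℝ (Fin k), ∃ w, Carries X x m y n w ∧ CycleFree w.support ∧
      ∀ m' ∈ stdSimplex ℝ (Fin k), ∀ w', Carries X x m' y n w' →
        chainCost α w ≤ chainCost α w' := by
  have : NeZero k := ⟨hk.ne'⟩
  have hfam : ∀ m' ∈ stdSimplex ℝ (Fin k), ∀ w', Carries X x m' y n w' →
      ∃ p ∈ segmentFamilies X x y n (3 * (k + ℓ)),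
        ∑ i, p.2.1 i ^ α * dist (p.1 i).1 (p.1 i).2 ≤ chainCost α w' := by
    intro m' hm' w' hw'
    obtain ⟨w'', h1, h2, h3, h4⟩ := hw'.exists_reduced hα0 hα1
    obtain ⟨p, hp, hpc⟩ := exists_mem_segmentFamilies (hxX 0) α hm' hn hn1 h1 h3 h4
    exact ⟨p, hp, hpc.trans_le h2⟩
  obtain ⟨m₀, hm₀, w₀, hw₀⟩ := exists_carries (X := X) (x := x) hxX hyX hn hn1
  obtain ⟨p₀, hp₀, -⟩ := hfam m₀ hm₀ w₀ hw₀
  have hcont : Continuous fun p : (Fin (3 * (k + ℓ)) →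
      EuclideanSpace ℝ (Fin d) × EuclideanSpace ℝ (Fin d)) × (Fin (3 * (k + ℓ)) → ℝ) ×
      (Fin k → ℝ) => ∑ i, p.2.1 i ^ α * dist (p.1 i).1 (p.1 i).2 := by
    refine continuous_finsetSum _ fun i _ => Continuous.mul ?_ (by fun_prop)
    exact (Real.continuous_rpow_const hα0).comp (by fun_prop)
  obtain ⟨p, hp, hmin⟩ := (isCompact_segmentFamilies (x := x) (y := y) (n := n) hX
    (3 * (k + ℓ))).exists_isMinOn ⟨p₀, hp₀⟩ hcont.continuousOn
  obtain ⟨w, hw, hwc⟩ := exists_carries_of_mem_segmentFamilies hα0 hα1 hp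
  obtain ⟨w₁, h1, h2, h3, -⟩ := hw.exists_reduced hα0 hα1
  refine ⟨p.2.2, hp.1.2.2, w₁, h1, h3, fun m' hm' w' hw' => ?_⟩
  obtain ⟨p', hp', hpc'⟩ := hfam m' hm' w' hw'
  exact h2.trans (hwc.trans ((hmin hp').trans hpc'))

end Transport

end RamifiedAllocation

theorem mainTheorem2 {d k ℓ : ℕ} (hk : 0 < k)
    (X : Set (EuclideanSpace ℝ (Fin d))) (hXcompact : IsCompact X) (hXconvex : Convex ℝ X)
    (x : Fin k → EuclideanSpace ℝ (Fin d)) (hx : Function.Injective x) (hxX : ∀ i, x i ∈ X)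
    (y : Fin ℓ → EuclideanSpace ℝ (Fin d)) (hy : Function.Injective y) (hyX : ∀ j, y j ∈ X)
    (n : Fin ℓ → ℝ) (hn : ∀ j, 0 < n j) (hn1 : ∑ j, n j = 1)
    (α : ℝ) (hα0 : 0 ≤ α) (hα1 : α < 1) :
    -- there is an optimal plan, and the minimum that defines its cost is attained by a path
    (∃ q ∈ RamifiedAllocation.allocationPlans k n,
      (∀ q' ∈ RamifiedAllocation.allocationPlans k n,
        RamifiedAllocation.planCost X α x y n q ≤ RamifiedAllocation.planCost X α x y n q') ∧
      ∃ G ∈ RamifiedAllocation.compatiblePaths X x y n q,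
        RamifiedAllocation.planCost X α x y n q = ENNReal.ofReal (G.cost α)) ∧
    -- there is an optimal production vector, and the minimum that defines `d_α` is attained there
    (∃ m ∈ stdSimplex ℝ (Fin k),
      (∀ m' ∈ stdSimplex ℝ (Fin k),
        RamifiedAllocation.minCost X α (RamifiedAllocation.atomicMeasure x m)
            (RamifiedAllocation.atomicMeasure y n) ≤
          RamifiedAllocation.minCost X α (RamifiedAllocation.atomicMeasure x m')
            (RamifiedAllocation.atomicMeasure y n)) ∧
      ∃ G ∈ RamifiedAllocation.transportPaths X (RamifiedAllocation.atomicMeasure x m)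
          (RamifiedAllocation.atomicMeasure y n),
        RamifiedAllocation.minCost X α (RamifiedAllocation.atomicMeasure x m)
            (RamifiedAllocation.atomicMeasure y n) = ENNReal.ofReal (G.cost α)) ∧
    -- the two minimum values agree
    (∃ v : ℝ, 0 ≤ v ∧
      IsLeast (RamifiedAllocation.planCost X α x y n '' RamifiedAllocation.allocationPlans k n)
        (ENNReal.ofReal v) ∧
      IsLeast ((fun m : Fin k → ℝ =>
          RamifiedAllocation.minCost X α (RamifiedAllocation.atomicMeasure x m)
            (RamifiedAllocation.atomicMeasure y n)) '' stdSimplex ℝ (Fin k))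
        (ENNReal.ofReal v)) := by
  have hn0 : ∀ j, 0 ≤ n j := fun j => (hn j).le
  obtain ⟨m, hm, w, hw, hS, hmin⟩ := RamifiedAllocation.exists_minimal_carries hα0 hα1.le hk
    hXcompact hxX hyX hn0 hn1
  obtain ⟨G, hG, hGmin⟩ : ∃ G ∈ RamifiedAllocation.transportPaths X
      (RamifiedAllocation.atomicMeasure x m) (RamifiedAllocation.atomicMeasure y n),
      ∀ m' ∈ stdSimplex ℝ (Fin k), ∀ G' ∈ RamifiedAllocation.transportPaths X
        (RamifiedAllocation.atomicMeasure x m') (RamifiedAllocation.atomicMeasure y n),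
        ENNReal.ofReal (G.cost α) ≤ ENNReal.ofReal (G'.cost α) := by
    refine ⟨_, RamifiedAllocation.ofChain_mem_transportPaths hxX hyX hm.1 hn0 hw hS,
      fun m' hm' G' hG' => ENNReal.ofReal_le_ofReal ?_⟩
    rw [← RamifiedAllocation.WeightedDigraph.chainCost_toChain,
      ← RamifiedAllocation.WeightedDigraph.chainCost_toChain, RamifiedAllocation.toChain_ofChain]
    exact hmin m' hm' _ (RamifiedAllocation.carries_toChain hm'.1 hn0 hG')
  -- `G` is optimal for both problems: it is compatible with a plan of production `m`
  obtain ⟨q, hq, hGq⟩ := RamifiedAllocation.exists_mem_compatiblePaths hm.1 hn hG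
  have hlower : ∀ m' ∈ stdSimplex ℝ (Fin k), ENNReal.ofReal (G.cost α) ≤
      RamifiedAllocation.minCost X α (RamifiedAllocation.atomicMeasure x m')
        (RamifiedAllocation.atomicMeasure y n) := fun m' hm' => le_iInf₂ (hGmin m' hm')
  have hlower' : ∀ q' ∈ RamifiedAllocation.allocationPlans k n, ENNReal.ofReal (G.cost α) ≤
      RamifiedAllocation.planCost X α x y n q' := by
    refine fun q' hq' => le_iInf₂ fun G' hG' =>
      hGmin (RamifiedAllocation.production q') ⟨fun i => ?_, ?_⟩ G' hG'.1
    · exact Finset.sum_nonneg fun j _ => hq'.1 i j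
    · simp only [RamifiedAllocation.production]
      rw [Finset.sum_comm]
      simp only [hq'.2, hn1]
  have hmeq : RamifiedAllocation.minCost X α (RamifiedAllocation.atomicMeasure x m)
      (RamifiedAllocation.atomicMeasure y n) = ENNReal.ofReal (G.cost α) :=
    le_antisymm (iInf₂_le G hG) (hlower m hm)
  have hqeq : RamifiedAllocation.planCost X α x y n q = ENNReal.ofReal (G.cost α) :=
    le_antisymm (iInf₂_le G hGq) (hlower' q hq)
  refine ⟨⟨q, hq, fun q' hq' => hqeq.trans_le (hlower' q' hq'), G, hGq, hqeq⟩,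
    ⟨m, hm, fun m' hm' => hmeq.trans_le (hlower m' hm'), G, hG, hmeq⟩,
    G.cost α, ?_, ⟨⟨q, hq, hqeq⟩, ?_⟩, ⟨⟨m, hm, hmeq⟩, ?_⟩⟩
  · exact Finset.sum_nonneg fun e he =>
      mul_nonneg (Real.rpow_nonneg (G.weight_pos e he).le α) dist_nonneg
  · rintro _ ⟨q', hq', rfl⟩
    exact hlower' q' hq'
  · rintro _ ⟨m', hm', rfl⟩
    exact hlower m' hm'
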